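/- **Setting.** Let $d\ge 1$, let $\bar{\mathcal X}\subset\mathbb R^d$ be a bounded convex set, let $f:\bar{\mathcal X}\to[0,1]$ be convex with a minimiser $x^*\in\bar{\mathcal X}$, put $f^*=f(x^*)$, and extend $f$ by $+\infty$ outside $\bar{\mathcal X}$. A query at a point $x\in\bar{\mathcal X}$ returns a noisy observation in $[0,1]$ which, given $x$, is independent of the past and has mean $f(x)$ (its law may differ from query to query); a query outside $\bar{\mathcal X}$ returns $+\infty$. Let $\mathcal X\subset\bar{\mathcal X}$ be convex with nonzero volume, with barycenter $\mu$ and covariance matrix $\Sigma$ (of the uniform law on $\mathcal X$), and let $$F(x)=d^{-1/2}\,\Sigma^{-1/2}(x-\mu),\qquad \bar{\mathcal Z}=F(\bar{\mathcal X}),\qquad g=f\circ F^{-1},\qquad g_c(z)=\mathbb E\,g(z+Z),$$ where $Z$ is uniform on the Euclidean ball $\mathbb B_2(0,c)$, $c>0$. For $N\ge1$ let $M=M_{\mathrm{FCP}}(N)=\log(2N)/\log(17/16)+1$, and let $\eta(u)=4\sqrt{\log(2u)}$. **Algorithm.** $\mathbf{FCP}(z,\mathcal X,c,N,s,\delta)$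 does the following. It makes $N$ queries of $f$ at $F^{-1}(z)$ and lets $\hat g_z$ be their mean. For every integer $1\le i\le \log_2 N+1$ it draws $2^i$ independent uniform points $z^{(i)}_1,\dots,z^{(i)}_{2^i}$ in $\mathbb B_2(z,2c)$, makes $\lfloor 2^{-i}N/i^2\rfloor$ queries of $f$ at each $F^{-1}(z^{(i)}_j)$, and, if this number is not $0$, lets $\hat g_{z^{(i)}_j}$ be their mean (points without observations are never selected). If there is a $z^{(i)}_j$ with $$\hat g_{z_j^{(i)}}-\hat g_z\ \ge\ \frac{(17/16)^s}{16N}+4\,\eta\!\left(\frac{2^i i^2 M}{\delta}\right)\sqrt{\frac{i^2 2^i}{N}},$$ it calls $\mathbf{FCP}(z^{(i)}_j,\mathcal X,c,N,s+1,\delta)$ for one such $(i,j)$, chosen by an arbitrary rule; otherwise it returns $(z,\hat g_z)$. **Proposition.** Let $c>0$, $\delta>0$, let $N\geq 1$ be an integer, and let $z_0\in\mathbb R^d$ be such that $\mathbb B_2(z_0,2Mc)\subset\bar{\mathcal Z}$ (closed ball). Then with probability at least $1-4\delta$, $\mathbf{FCP}(z_0,\mathcal X,c,N,0,\delta)$ terminates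 and returns $(z,\hat g_z)$ such that 1. either $g_{2c}(z)-g_c(z)\le 2^{-3}\,(g_c(z)-f^*)$, or $g(z)-f^*\le 2^{15}\,\eta(M/\delta)\,\log(2M/\delta)\,\dfrac1{\sqrt N}$; 2. $|g(z)-\hat g_z|\le \eta(M/\delta)/\sqrt N$; 3. $\|z-z_0\|_2\le 2Mc$; 4. the total number $T$ of queries made satisfies $N\le T\le 4MN$. -/

import Mathlib

open MeasureTheory ProbabilityTheory Metric
open scoped ENNReal

noncomputable section

namespace ZerothOrder

/-- The ambient space `ℝ^d` with its Euclidean norm. -/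
abbrev E (d : ℕ) := EuclideanSpace ℝ (Fin d)

/-! ### The normalising affine map of a convex set -/

/-- The uniform probability measure on `S` (for `S` of finite nonzero volume). -/
def unif {d : ℕ} (S : Set (E d)) : Measure (E d) := cond volume S

/-- The barycenter of `X`. -/
def barycenter {d : ℕ} (X : Set (E d)) : E d := ∫ x, x ∂(unif X)

/-- The variance-covariance matrix of the uniform distribution on `X`. -/
def covMat {d : ℕ} (X : Set (E d)) : Matrix (Fin d) (Fin d) ℝ :=
  Matrix.of fun i j => covariance (fun x : E d => x i) (fun x : E d => x j) (unif X)

open scoped MatrixOrder in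
/-- The positive semidefinite square root of the variance-covariance matrix. -/
def sqrtCov {d : ℕ} (X : Set (E d)) : Matrix (Fin d) (Fin d) ℝ := CFC.sqrt (covMat X)

/-- `F_X x = d^{-1/2} Σ_X^{-1/2} (x - μ_X)`. -/
def toZ {d : ℕ} (X : Set (E d)) (x : E d) : E d :=
  (1 / √(d : ℝ)) • Matrix.toEuclideanLin (sqrtCov X)⁻¹ (x - barycenter X)

/-- `F_X⁻¹ z = d^{1/2} Σ_X^{1/2} z + μ_X`, the inverse of `toZ` when `X` is bounded, convex and of
nonzero volume, and `1 ≤ d`. -/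
def toX {d : ℕ} (X : Set (E d)) (z : E d) : E d :=
  √(d : ℝ) • Matrix.toEuclideanLin (sqrtCov X) z + barycenter X

/-! ### The objective function and its smoothed proxies -/

open Classical in
/-- The objective `f ≥ 0`, extended by `+∞` outside of `Xbar`. -/
def extend {d : ℕ} (Xbar : Set (E d)) (f : E d → ℝ) (x : E d) : ℝ≥0∞ :=
  if x ∈ Xbar then ENNReal.ofReal (f x) else ∞

/-- `g z = f (F_X⁻¹ z)`, with value `+∞` outside of the transformed domain. -/
def g {d : ℕ} (Xbar : Set (E d)) (f : E d → ℝ) (X : Set (E d)) (z : E d) : ℝ≥0∞ :=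
  extend Xbar f (toX X z)

/-- `g_c z`, the mean of `g (z + Z)` for `Z` uniform on the ball of radius `c > 0` around `0`. -/
def smooth {d : ℕ} (Xbar : Set (E d)) (f : E d → ℝ) (X : Set (E d)) (c : ℝ) (z : E d) : ℝ≥0∞ :=
  ∫⁻ u, g Xbar f X (z + u) ∂(unif (closedBall (0 : E d) c))

/-- The law `κ x` of a noisy observation made at the point `x`: inside `Xbar` it takes values in
`[0,1]` and has mean `f x`, outside of `Xbar` the observation is `+∞`. -/
structure IsObservationKernel {d : ℕ} (Xbar : Set (E d)) (f : E d → ℝ)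
    (κ : Kernel (E d) ℝ≥0∞) : Prop where
  markov : IsMarkovKernel κ
  le_one : ∀ x ∈ Xbar, ∀ᵐ y ∂(κ x), y ≤ 1
  mean : ∀ x ∈ Xbar, ∫⁻ y, y ∂(κ x) = ENNReal.ofReal (f x)
  outside : ∀ x, x ∉ Xbar → κ x = Measure.dirac ∞

/-! ### The algorithm `FCP` -/

/-- `η_conc(u) = 4 √(log (2u))`, so that `η_conc(1/δ) = 4 √(log (2/δ))`. -/
def etaConc (u : ℝ) : ℝ := 4 * √(Real.log (2 * u))

/-- `M_FCP(N) = log (2N) / log (17/16) + 1`. -/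
def MFCP (N : ℕ) : ℝ := Real.log (2 * N) / Real.log (17 / 16) + 1

/-- The levels `i` used in one round: the integers `1 ≤ i ≤ log₂ N + 1`. -/
abbrev levels (N : ℕ) : Finset ℕ := Finset.Icc 1 (Nat.log 2 N + 1)

/-- The candidates `(i, j)` of one round: `2^i` of them on level `i`. -/
abbrev Cand (N : ℕ) := Σ i : levels N, Fin (2 ^ (i : ℕ))

/-- The number `⌊2^{-i} N / i²⌋` of observations made at each candidate of level `i`. -/
def reps (N i : ℕ) : ℕ := N / (2 ^ i * i ^ 2)

/-- The queries made in one round: `N` of them at the current point and `reps N i` of them at each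
candidate of level `i`. -/
abbrev Query (N : ℕ) := Fin N ⊕ (Σ q : Cand N, Fin (reps N q.1))

/-- The point (in the transformed space) at which a query is made in a round with current
point `z` and candidate points `p`. -/
def queryPoint {d N : ℕ} (z : E d) (p : Cand N → E d) : Query N → E d
  | Sum.inl _ => z
  | Sum.inr a => p a.1

/-- The estimator of `g z` at the current point: the mean of the `N` observations made there. -/
def centerEst {N : ℕ} (y : Query N → ℝ≥0∞) : ℝ≥0∞ := (∑ k : Fin N, y (Sum.inl k)) / N

/-- The estimator at the candidate `q`: the mean of the observations made there. -/
def candEst {N : ℕ} (y : Query N → ℝ≥0∞) (q : Cand N) : ℝ≥0∞ :=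
  (∑ k : Fin (reps N q.1), y (Sum.inr ⟨q, k⟩)) / (reps N q.1 : ℕ)

/-- The selection threshold of level `i` in round `s`. -/
def threshold (N : ℕ) (δ : ℝ) (s i : ℕ) : ℝ :=
  (17 / 16 : ℝ) ^ s / (16 * N) +
    4 * etaConc (2 ^ i * (i : ℝ) ^ 2 * MFCP N / δ) * √((i : ℝ) ^ 2 * 2 ^ i / N)

/-- The candidate `q` has been observed at least once and passes the selection test of round `s`.
The threshold is positive for `1 ≤ N`, so the truncated difference gives the test on real
estimates; an estimate `+∞` at the current point makes every test fail. -/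
def Eligible {N : ℕ} (δ : ℝ) (s : ℕ) (y : Query N → ℝ≥0∞) (q : Cand N) : Prop :=
  0 < reps N q.1 ∧ ENNReal.ofReal (threshold N δ s q.1) ≤ candEst y q - centerEst y

/-- Given the observations `obs r` of each round `r`, round `s` takes place: a candidate was
eligible in every earlier round, so that `FCP` called itself recursively. -/
def Reached {N : ℕ} (δ : ℝ) (obs : ℕ → Query N → ℝ≥0∞) (s : ℕ) : Prop :=
  ∀ r < s, ∃ q, Eligible δ r (obs r) q

/-- `FCP` returns in round `s`: this round takes place, and no candidate is eligible in it. -/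
def ReturnsAt {N : ℕ} (δ : ℝ) (obs : ℕ → Query N → ℝ≥0∞) (s : ℕ) : Prop :=
  Reached δ obs s ∧ ∀ q, ¬ Eligible δ s (obs s) q

/-- The number of noisy observations made when `FCP` returns in round `s`. -/
def budget (N s : ℕ) : ℕ := ∑ _r ∈ Finset.range (s + 1), Fintype.card (Query N)

/-- `(z, p, obs)` is an execution of `FCP(z₀, X, c, N, 0, δ)` on the probability space `(Ω, P)`,
where `z s` is the current point, `p s` are the candidate points and `obs s` the observations of
round `s`. The σ-algebra `ℱ (2s)` describes what has happened before round `s`, `ℱ (2s+1)` adds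
the candidate points of round `s`, and `ℱ (2s+2)` its observations and the choice of the next
point. Laws are prescribed only for rounds that take place:

* given `ℱ (2s)`, the candidate points are independent and uniform on the closed ball of radius
  `2c` around `z s`;
* given `ℱ (2s+1)`, the observations are independent, and the one made by query `a` has law
  `ν s a x`, where `x` is the point of the original space that is queried;
* if some candidate is eligible, then the next point is an eligible candidate, chosen by an
  arbitrary rule. -/
structure IsFCPRun {d N : ℕ} {Ω : Type*} {mΩ : MeasurableSpace Ω} (P : Measure Ω)
    (ℱ : Filtration ℕ mΩ)
    (X : Set (E d)) (c δ : ℝ) (z₀ : E d)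
    (ν : ℕ → Query N → Kernel (E d) ℝ≥0∞)
    (z : ℕ → Ω → E d) (p : ℕ → Ω → Cand N → E d) (obs : ℕ → Ω → Query N → ℝ≥0∞) : Prop where
  measurable_point : ∀ s, Measurable[ℱ (2 * s)] (z s)
  measurable_cand : ∀ s, Measurable[ℱ (2 * s + 1)] (p s)
  measurable_obs : ∀ s, Measurable[ℱ (2 * s + 2)] (obs s)
  start : ∀ ω, z 0 ω = z₀
  law_cand : ∀ s (A : Set Ω) (B : Set (Cand N → E d)), MeasurableSet[ℱ (2 * s)] A →
    (∀ ω ∈ A, Reached δ (fun r => obs r ω) s) → MeasurableSet B →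
    P (A ∩ p s ⁻¹' B) =
      ∫⁻ ω in A, Measure.pi (fun _ : Cand N => unif (closedBall (z s ω) (2 * c))) B ∂P
  law_obs : ∀ s (A : Set Ω) (B : Set (Query N → ℝ≥0∞)), MeasurableSet[ℱ (2 * s + 1)] A →
    (∀ ω ∈ A, Reached δ (fun r => obs r ω) s) → MeasurableSet B →
    P (A ∩ obs s ⁻¹' B) =
      ∫⁻ ω in A, Measure.pi
        (fun a : Query N => ν s a (toX X (queryPoint (z s ω) (p s ω) a))) B ∂P
  step : ∀ s ω, Reached δ (fun r => obs r ω) (s + 1) →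
    ∃ q, Eligible δ s (obs s ω) q ∧ z (s + 1) ω = p s ω q

end ZerothOrder

end

noncomputable section

namespace ZerothOrder

section

/-! The value at the current point must grow geometrically until `FCP` returns. While all estimates
are accurate, the call made in round `s` raises `g` by at least `(17/16)^s / (16 N)`, so after `s`
calls `g` has gained `((17/16)^s - 1) / N`. Since `g` takes values in `[0, 1]` on the ball,
`(17/16)^s ≤ N + 1`, hence `s ≤ M - 1` (`IsFCPRun.invariant`). This gives termination, the distance
bound and the budget.

For the guarantee at the returned `z`, put `D = g z - f*` and `Y = g u - g z` with `u` uniform on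
the ball of radius `2c`. If `z` is neither flat nor nearly optimal, Jensen's inequality gives `E Y >
D / 8`. The accumulated gain bounds the first term of the threshold by about `D / 16`, so much of
the mean of `Y` lies above it. Peeling over the level widths then finds a level `i` at which `Y` is
large with probability more than `log (M/δ) / 2^i` (`exists_heavy_level`). All `2^i` candidates of
that level miss this event with probability at most `δ / M` (`pi_miss_le`), and a candidate that
hits it is eligible when the estimates are accurate, so `FCP` would not have returned.

By Hoeffding's inequality the estimates of a round fail with probability at most `2δ / M`. At most
`M` rounds matter, so the total failure probability is at most `3δ`. -/

theorem twelve_le_MFCP {N : ℕ} (hN : 1 ≤ N) : 12 ≤ MFCP N := by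
  have h1 : Real.log (17 / 16) ≤ 1 / 16 := by
    have := Real.log_le_sub_one_of_pos (show (0 : ℝ) < 17 / 16 by norm_num)
    linarith
  have h0 : 0 < Real.log (17 / 16) := Real.log_pos (by norm_num)
  have h2 : Real.log 2 ≤ Real.log (2 * N) := by
    apply Real.log_le_log (by norm_num)
    have : (1 : ℝ) ≤ N := by exact_mod_cast hN
    linarith
  have h3 := Real.log_two_gt_d9
  -- `16 * log 2 > 11`.
  have : 11 ≤ Real.log (2 * N) / Real.log (17 / 16) := by
    rw [le_div_iff₀ h0]
    nlinarith
  unfold MFCP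
  linarith

/-! ### Inverting the normalising map; measurability of `g` -/

variable {d : ℕ} {Xbar X : Set (E d)} {f : E d → ℝ}

/-- The inverse of a singular matrix is `0` by convention, so `toZ` would then be constantly `0` and
its image could not contain a ball of positive radius. The covariance itself need not be studied. -/
theorem isUnit_det_sqrtCov (hd : 1 ≤ d) {z₀ : E d} {R : ℝ} (hR : 0 < R)
    (hball : closedBall z₀ R ⊆ toZ X '' Xbar) : IsUnit (sqrtCov X).det := by
  by_contra h
  have hz : ∀ z ∈ closedBall z₀ R, z = 0 := by
    intro z hz
    obtain ⟨x, -, rfl⟩ := hball hz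
    simp [toZ, Matrix.nonsing_inv_apply_not_isUnit _ h]
  have h0 : z₀ = 0 := hz z₀ (mem_closedBall_self hR.le)
  let i : Fin d := ⟨0, hd⟩
  have h1 := hz (EuclideanSpace.single i R) (by simp [h0, abs_of_pos hR])
  have h2 := congrArg (fun v : E d => v i) h1
  simp at h2
  exact hR.ne' h2

theorem toX_toZ (hd : 1 ≤ d) (h : IsUnit (sqrtCov X).det) (x : E d) : toX X (toZ X x) = x := by
  have hd' : √(d : ℝ) ≠ 0 := by
    have : (0 : ℝ) < d := by exact_mod_cast hd
    positivity
  have hm : ∀ v : E d, Matrix.toEuclideanLin (sqrtCov X)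
      (Matrix.toEuclideanLin (sqrtCov X)⁻¹ v) = v := by
    intro v
    ext i
    simp [Matrix.toLpLin_apply, Matrix.mulVec_mulVec, Matrix.mul_nonsing_inv _ h]
  simp only [toX, toZ, map_smul, hm, smul_smul]
  rw [mul_one_div_cancel hd', one_smul, sub_add_cancel]

theorem toX_mem (hd : 1 ≤ d) {z₀ : E d} {R : ℝ} (hR : 0 < R)
    (hball : closedBall z₀ R ⊆ toZ X '' Xbar) {z : E d} (hz : z ∈ closedBall z₀ R) :
    toX X z ∈ Xbar := by
  obtain ⟨x, hx, rfl⟩ := hball hz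
  rwa [toX_toZ hd (isUnit_det_sqrtCov hd hR hball)]

theorem continuous_toX : Continuous (toX X) := by
  unfold toX
  have := (Matrix.toEuclideanLin (sqrtCov X)).continuous_of_finiteDimensional
  fun_prop

theorem toX_affine {a b : ℝ} (hab : a + b = 1) (x y : E d) :
    toX X (a • x + b • y) = a • toX X x + b • toX X y := by
  simp only [toX, map_add, map_smul]
  have : barycenter X = a • barycenter X + b • barycenter X := by rw [← add_smul, hab, one_smul]
  conv_lhs => rw [this]
  module

/-- No measurability of `f` or `Xbar` is assumed: the extended objective is the mean of the kernel,
both inside and outside of `Xbar`. -/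
theorem IsObservationKernel.measurable_extend {κ : Kernel (E d) ℝ≥0∞}
    (hκ : IsObservationKernel Xbar f κ) : Measurable (extend Xbar f) := by
  have : extend Xbar f = fun x => ∫⁻ y, y ∂(κ x) := by
    ext x
    by_cases hx : x ∈ Xbar
    · simp [extend, hx, hκ.mean x hx]
    · simp [extend, hx, hκ.outside x hx]
  rw [this]
  exact measurable_id.lintegral_kernel

/-- The real-valued version of `g`. -/
def gReal (Xbar : Set (E d)) (f : E d → ℝ) (X : Set (E d)) (z : E d) : ℝ := (g Xbar f X z).toReal

theorem measurable_g {κ : Kernel (E d) ℝ≥0∞} (hκ : IsObservationKernel Xbar f κ) :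
    Measurable (g Xbar f X) :=
  hκ.measurable_extend.comp continuous_toX.measurable

theorem measurable_gReal {κ : Kernel (E d) ℝ≥0∞} (hκ : IsObservationKernel Xbar f κ) :
    Measurable (gReal Xbar f X) :=
  (measurable_g hκ).ennreal_toReal

theorem g_eq {z : E d} (hz : toX X z ∈ Xbar) : g Xbar f X z = ENNReal.ofReal (f (toX X z)) := by
  simp [g, extend, hz]

theorem gReal_eq (hf01 : ∀ x ∈ Xbar, f x ∈ Set.Icc (0 : ℝ) 1) {z : E d} (hz : toX X z ∈ Xbar) :
    gReal Xbar f X z = f (toX X z) := by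
  rw [gReal, g_eq hz, ENNReal.toReal_ofReal (hf01 _ hz).1]

theorem g_ne_top {z : E d} (hz : toX X z ∈ Xbar) : g Xbar f X z ≠ ∞ := by
  rw [g_eq hz]; exact ENNReal.ofReal_ne_top

theorem gReal_mem (hf01 : ∀ x ∈ Xbar, f x ∈ Set.Icc (0 : ℝ) 1) {z : E d} (hz : toX X z ∈ Xbar) :
    gReal Xbar f X z ∈ Set.Icc (0 : ℝ) 1 := by
  rw [gReal_eq hf01 hz]; exact hf01 _ hz

/-! ### Uniform measures on balls -/

theorem isProbabilityMeasure_unif (z : E d) {r : ℝ} (hr : 0 < r) :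
    IsProbabilityMeasure (unif (closedBall z r)) :=
  cond_isProbabilityMeasure_of_finite (measure_closedBall_pos volume z hr).ne'
    measure_closedBall_lt_top.ne

theorem ae_mem_unif (z : E d) (r : ℝ) : ∀ᵐ u ∂(unif (closedBall z r)), u ∈ closedBall z r :=
  ae_cond_mem measurableSet_closedBall

theorem map_add_unif (z : E d) (r : ℝ) :
    (unif (closedBall (0 : E d) r)).map (fun u => z + u) = unif (closedBall z r) := by
  have hm : MeasurePreserving (fun u : E d => z + u) volume volume :=
    measurePreserving_add_left volume z
  have hpre : (fun u : E d => z + u) ⁻¹' closedBall z r = closedBall 0 r := by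
    ext u; simp
  have hvol : volume (closedBall z r) = volume (closedBall (0 : E d) r) := by
    rw [← hpre, hm.measure_preimage measurableSet_closedBall.nullMeasurableSet]
  ext A hA
  rw [Measure.map_apply (by fun_prop) hA, unif, unif,
    cond_apply measurableSet_closedBall, cond_apply measurableSet_closedBall, hvol,
    ← hm.measure_preimage ((measurableSet_closedBall.inter hA).nullMeasurableSet),
    Set.preimage_inter, hpre]

theorem map_neg_unif (r : ℝ) :
    (unif (closedBall (0 : E d) r)).map (fun u => -u) = unif (closedBall 0 r) := by
  have hm : MeasurePreserving (fun u : E d => -u) volume volume :=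
    Measure.measurePreserving_neg volume
  have hpre : (fun u : E d => -u) ⁻¹' closedBall 0 r = closedBall 0 r := by
    ext u; simp
  ext A hA
  rw [Measure.map_apply (by fun_prop) hA, unif,
    cond_apply measurableSet_closedBall, cond_apply measurableSet_closedBall]
  congr 1
  conv_rhs => rw [← hm.measure_preimage ((measurableSet_closedBall.inter hA).nullMeasurableSet),
    Set.preimage_inter, hpre]

/-- Seen as translates of one fixed law, these measures form a kernel in the centre, as needed to
condition on the current point. -/
theorem measurable_unif_closedBall {r : ℝ} (hr : 0 < r) :
    Measurable (fun z : E d => unif (closedBall z r)) := by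
  have := isProbabilityMeasure_unif (0 : E d) hr
  refine Measure.measurable_of_measurable_coe _ fun A hA => ?_
  have : (fun z : E d => unif (closedBall z r) A) =
      fun z => unif (closedBall 0 r) (Prod.mk z ⁻¹' ((fun q : E d × E d => q.1 + q.2) ⁻¹' A)) := by
    ext z
    rw [← map_add_unif, Measure.map_apply (by fun_prop) hA]
    rfl
  rw [this]
  exact measurable_measure_prodMk_left (measurable_fst.add measurable_snd hA)

/-! ### The smoothed function -/

theorem smooth_eq_lintegral {κ : Kernel (E d) ℝ≥0∞} (hκ : IsObservationKernel Xbar f κ) (c : ℝ)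
    (z : E d) : smooth Xbar f X c z = ∫⁻ u, g Xbar f X u ∂(unif (closedBall z c)) := by
  rw [← map_add_unif, lintegral_map (measurable_g hκ) (by fun_prop)]
  rfl

theorem measurable_smooth {κ : Kernel (E d) ℝ≥0∞} (hκ : IsObservationKernel Xbar f κ) {c : ℝ}
    (hc : 0 < c) : Measurable (smooth Xbar f X c) := by
  have := isProbabilityMeasure_unif (0 : E d) hc
  refine Measurable.lintegral_prod_right' (f := fun q : E d × E d => g Xbar f X (q.1 + q.2)) ?_
  exact (measurable_g hκ).comp (measurable_fst.add measurable_snd)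

section
variable {κ : Kernel (E d) ℝ≥0∞} (hκ : IsObservationKernel Xbar f κ)
  (hf01 : ∀ x ∈ Xbar, f x ∈ Set.Icc (0 : ℝ) 1) {r : ℝ} (hr : 0 < r) {z : E d}
  (hz : ∀ u ∈ closedBall z r, toX X u ∈ Xbar)
include hκ hf01 hr hz

theorem integrable_gReal : Integrable (gReal Xbar f X) (unif (closedBall z r)) := by
  have := isProbabilityMeasure_unif z hr
  refine Integrable.of_mem_Icc 0 1 (measurable_gReal hκ).aemeasurable ?_
  filter_upwards [ae_mem_unif z r] with u hu using gReal_mem hf01 (hz u hu)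

theorem smooth_eq_ofReal :
    smooth Xbar f X r z = ENNReal.ofReal (∫ u, gReal Xbar f X u ∂(unif (closedBall z r))) := by
  rw [smooth_eq_lintegral hκ, ofReal_integral_eq_lintegral_ofReal
    (integrable_gReal hκ hf01 hr hz) (Filter.Eventually.of_forall fun u => ENNReal.toReal_nonneg)]
  refine lintegral_congr_ae ?_
  filter_upwards [ae_mem_unif z r] with u hu
  rw [gReal, ENNReal.ofReal_toReal (g_ne_top (hz u hu))]

theorem smooth_ne_top : smooth Xbar f X r z ≠ ∞ := by
  rw [smooth_eq_ofReal hκ hf01 hr hz]; exact ENNReal.ofReal_ne_top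

theorem toReal_smooth :
    (smooth Xbar f X r z).toReal = ∫ u, gReal Xbar f X u ∂(unif (closedBall z r)) := by
  rw [smooth_eq_ofReal hκ hf01 hr hz, ENNReal.toReal_ofReal]
  exact integral_nonneg fun u => ENNReal.toReal_nonneg

/-- Jensen's inequality by symmetry: `u` and `-u` have the same law, and `z` is the midpoint of `z +
u` and `z - u`. -/
theorem gReal_le_toReal_smooth (hf : ConvexOn ℝ Xbar f) :
    gReal Xbar f X z ≤ (smooth Xbar f X r z).toReal := by
  rw [toReal_smooth hκ hf01 hr hz]
  have hp := isProbabilityMeasure_unif z hr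
  have hp0 := isProbabilityMeasure_unif (0 : E d) hr
  have hI := integrable_gReal hκ hf01 hr hz
  have hmeas := measurable_gReal (X := X) hκ
  have e1 : ∫ u, gReal Xbar f X u ∂(unif (closedBall z r)) =
      ∫ u, gReal Xbar f X (z + u) ∂(unif (closedBall 0 r)) := by
    rw [← map_add_unif, integral_map (by fun_prop) hmeas.aestronglyMeasurable]
  have e2 : ∫ u, gReal Xbar f X (z + u) ∂(unif (closedBall 0 r)) =
      ∫ u, gReal Xbar f X (z + -u) ∂(unif (closedBall 0 r)) := by
    conv_lhs => rw [← map_neg_unif]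
    rw [integral_map (by fun_prop)]
    exact (hmeas.comp (by fun_prop)).aestronglyMeasurable
  have i1 : Integrable (fun u => gReal Xbar f X (z + u)) (unif (closedBall 0 r)) := by
    rw [← map_add_unif] at hI
    exact (integrable_map_measure hmeas.aestronglyMeasurable (by fun_prop)).1 hI
  have i2 : Integrable (fun u => gReal Xbar f X (z + -u)) (unif (closedBall 0 r)) := by
    have := i1
    rw [← map_neg_unif] at this
    exact (integrable_map_measure (hmeas.comp (by fun_prop)).aestronglyMeasurable
      (by fun_prop)).1 this
  have hle : ∫ _u, 2 * gReal Xbar f X z ∂(unif (closedBall (0 : E d) r)) ≤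
      ∫ u, (gReal Xbar f X (z + u) + gReal Xbar f X (z + -u)) ∂(unif (closedBall 0 r)) := by
    refine integral_mono_ae (integrable_const _) (i1.add i2) ?_
    filter_upwards [ae_mem_unif (0 : E d) r] with u hu
    have h1 : toX X (z + u) ∈ Xbar := hz _ (by simpa using hu)
    have h2 : toX X (z + -u) ∈ Xbar := hz _ (by simpa using hu)
    have h0 : toX X z ∈ Xbar := hz _ (mem_closedBall_self hr.le)
    rw [gReal_eq hf01 h0, gReal_eq hf01 h1, gReal_eq hf01 h2]
    have hmid : z = (1 / 2 : ℝ) • (z + u) + (1 / 2 : ℝ) • (z + -u) := by module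
    have := hf.2 h1 h2 (show (0 : ℝ) ≤ 1 / 2 by norm_num) (show (0 : ℝ) ≤ 1 / 2 by norm_num)
      (by norm_num)
    rw [← toX_affine (by norm_num), ← hmid] at this
    simp only [smul_eq_mul] at this
    linarith
  rw [integral_add i1 i2, ← e2] at hle
  simp only [integral_const, probReal_univ, smul_eq_mul, one_mul] at hle
  linarith
end

end

/-! ### Numerical facts -/

/-- The width `η (2^i i² M / δ) √(i² 2^i / N)` of the confidence interval at level `i`. -/
def levelWidth (N : ℕ) (δ : ℝ) (i : ℕ) : ℝ :=
  etaConc (2 ^ i * (i : ℝ) ^ 2 * MFCP N / δ) * √((i : ℝ) ^ 2 * 2 ^ i / N)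

theorem levelWidth_nonneg (N : ℕ) (δ : ℝ) (i : ℕ) : 0 ≤ levelWidth N δ i := by
  unfold levelWidth etaConc; positivity

theorem threshold_eq (N : ℕ) (δ : ℝ) (s i : ℕ) :
    threshold N δ s i = (17 / 16 : ℝ) ^ s / (16 * N) + 4 * levelWidth N δ i := by
  unfold threshold levelWidth; ring

section
variable {N : ℕ} {δ : ℝ}

theorem four_le_log (hN : 1 ≤ N) (hδ : 0 < δ) (hδ4 : δ < 1 / 4) :
    4 ≤ Real.log (2 * MFCP N / δ) := by
  have hM := twelve_le_MFCP hN
  have h96 : (96 : ℝ) ≤ 2 * MFCP N / δ := by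
    -- `2 * 12 / (1/4) = 96`, which exceeds `3 ^ 4 > exp 4`.
    rw [le_div_iff₀ hδ]; nlinarith
  rw [Real.le_log_iff_exp_le (by linarith)]
  have h1 : Real.exp 4 = Real.exp 1 ^ 4 := by rw [← Real.exp_nat_mul]; norm_num
  have h2 := Real.exp_one_lt_d9
  have h3 : Real.exp 1 ^ 4 ≤ 3 ^ 4 :=
    pow_le_pow_left₀ (Real.exp_pos _).le (by linarith) 4
  rw [h1]
  linarith

theorem levelLog_eq (hN : 1 ≤ N) (hδ : 0 < δ) {i : ℕ} (hi : 1 ≤ i) :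
    Real.log (2 * (2 ^ i * (i : ℝ) ^ 2 * MFCP N / δ)) =
      Real.log (2 * MFCP N / δ) + i * Real.log 2 + 2 * Real.log i := by
  have hM := twelve_le_MFCP hN
  have hM0 : 0 < MFCP N := by linarith
  have hi0 : (0 : ℝ) < i := by exact_mod_cast hi
  have : 2 * (2 ^ i * (i : ℝ) ^ 2 * MFCP N / δ) = (2 * MFCP N / δ) * 2 ^ i * (i : ℝ) ^ 2 := by ring
  rw [this, Real.log_mul (by positivity) (by positivity), Real.log_mul (by positivity)
    (by positivity), Real.log_pow, Real.log_pow]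
  norm_num

theorem levelLog_ge (hN : 1 ≤ N) (hδ : 0 < δ) {i : ℕ} (hi : 1 ≤ i) :
    Real.log (2 * MFCP N / δ) ≤ Real.log (2 * (2 ^ i * (i : ℝ) ^ 2 * MFCP N / δ)) := by
  rw [levelLog_eq hN hδ hi]
  have h2 : 0 ≤ Real.log 2 := Real.log_nonneg (by norm_num)
  have h3 : 0 ≤ Real.log i := Real.log_natCast_nonneg i
  have : 0 ≤ (i : ℝ) * Real.log 2 := by positivity
  linarith

/-- The logarithm is at least `4`, whereas `i log 2 + 2 log i ≤ i log 2 + 2 (i - 1) < 4 i`. -/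
theorem levelLog_le (hN : 1 ≤ N) (hδ : 0 < δ) (hδ4 : δ < 1 / 4) {i : ℕ} (hi : 1 ≤ i) :
    Real.log (2 * (2 ^ i * (i : ℝ) ^ 2 * MFCP N / δ)) ≤ Real.log (2 * MFCP N / δ) * (1 + i) := by
  rw [levelLog_eq hN hδ hi]
  have h4 := four_le_log hN hδ hδ4
  have hi0 : (1 : ℝ) ≤ i := by exact_mod_cast hi
  have h2 := Real.log_two_lt_d9
  have h3 := Real.log_le_sub_one_of_pos (show (0 : ℝ) < i by linarith)
  nlinarith

theorem eta_le_levelEta (hN : 1 ≤ N) (hδ : 0 < δ) {i : ℕ} (hi : 1 ≤ i) :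
    etaConc (MFCP N / δ) ≤ etaConc (2 ^ i * (i : ℝ) ^ 2 * MFCP N / δ) := by
  unfold etaConc
  have := levelLog_ge hN hδ hi
  rw [← mul_div_assoc]
  gcongr

/-- The error at the current point is thus within the width of any level, so comparing it with a
candidate costs at most two level widths. -/
theorem eta_div_le_levelWidth (hN : 1 ≤ N) (hδ : 0 < δ) {i : ℕ} (hi : 1 ≤ i) :
    etaConc (MFCP N / δ) / √(N : ℝ) ≤ levelWidth N δ i := by
  have h := eta_le_levelEta hN hδ hi
  have h0 : 0 ≤ etaConc (MFCP N / δ) := by unfold etaConc; positivity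
  have h1 : (1 : ℝ) ≤ (i : ℝ) ^ 2 * 2 ^ i := by
    have hi0 : (1 : ℝ) ≤ i := by exact_mod_cast hi
    exact one_le_mul_of_one_le_of_one_le (one_le_pow₀ hi0) (one_le_pow₀ (by norm_num))
  unfold levelWidth
  rw [div_eq_mul_inv, ← Real.sqrt_inv]
  refine mul_le_mul h ?_ (by positivity) (h0.trans h)
  apply Real.sqrt_le_sqrt
  rw [inv_eq_one_div]
  gcongr

/-- At a level without observations the width exceeds the whole range of `g`, so the peeling can
stop there. -/
theorem one_le_levelWidth_of_reps_eq_zero (hN : 1 ≤ N) (hδ : 0 < δ) (hδ4 : δ < 1 / 4) {i : ℕ}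
    (hi : 1 ≤ i) (hr : reps N i = 0) : 1 ≤ levelWidth N δ i := by
  have h1 : N < 2 ^ i * i ^ 2 := by
    unfold reps at hr
    exact (Nat.div_eq_zero_iff.1 hr).resolve_left (by positivity)
  have hN0 : (0 : ℝ) < N := by exact_mod_cast hN
  have h2 : (1 : ℝ) ≤ (i : ℝ) ^ 2 * 2 ^ i / N := by
    rw [le_div_iff₀ hN0, one_mul, mul_comm]
    exact_mod_cast h1.le
  have h4 := four_le_log hN hδ hδ4
  have h5 := levelLog_ge hN hδ hi
  unfold levelWidth etaConc
  have h6 : 1 ≤ √((i : ℝ) ^ 2 * 2 ^ i / N) := Real.one_le_sqrt.2 h2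
  have h7 : 1 ≤ √(Real.log (2 * (2 ^ i * (i : ℝ) ^ 2 * MFCP N / δ))) :=
    Real.one_le_sqrt.2 (by linarith)
  nlinarith

/-- The decay comes from `√(2^(i+1)) / 2^i = √2 (√2/2)^i`. Replacing `√2` by `3/2` gives the
rational ratio `3/4`, for which the weights have a closed-form sum. -/
theorem levelWidth_succ_le (hN : 1 ≤ N) (hδ : 0 < δ) (hδ4 : δ < 1 / 4) (i : ℕ) :
    levelWidth N δ (i + 1) / 2 ^ i ≤
      6 * √(Real.log (2 * MFCP N / δ)) / √(N : ℝ) *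
        (((i : ℝ) + 1) * (i + 3) / 2 * (3 / 4) ^ i) := by
  have h4 := four_le_log hN hδ hδ4
  have hN0 : (0 : ℝ) < N := by exact_mod_cast hN
  have hl := levelLog_le hN hδ hδ4 (i := i + 1) (by omega)
  set l := Real.log (2 * MFCP N / δ)
  have h1 : etaConc (2 ^ (i + 1) * ((i + 1 : ℕ) : ℝ) ^ 2 * MFCP N / δ) ≤
      4 * (√l * (((i : ℝ) + 3) / 2)) := by
    unfold etaConc
    gcongr
    rw [Real.sqrt_le_left (by positivity), mul_pow, Real.sq_sqrt (by linarith)]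
    refine hl.trans ?_
    gcongr
    push_cast
    -- `((i + 3) / 2)^2 - (i + 2) = ((i + 1) / 2)^2`.
    nlinarith [sq_nonneg ((i : ℝ) + 1)]
  have h2 : √(((i + 1 : ℕ) : ℝ) ^ 2 * 2 ^ (i + 1) / N) / 2 ^ i ≤
      ((i : ℝ) + 1) * ((3 / 2) * (3 / 4) ^ i) / √(N : ℝ) := by
    have hs : √((2 : ℝ)) ≤ 3 / 2 := by
      rw [Real.sqrt_le_left (by norm_num)]; norm_num
    have hs2 : √((2 : ℝ)) * √2 = 2 := Real.mul_self_sqrt (by norm_num)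
    rw [Real.sqrt_div' _ hN0.le, Real.sqrt_mul' _ (by positivity), Real.sqrt_sq (by positivity),
      div_right_comm, mul_div_assoc]
    have hp : √((2 : ℝ) ^ (i + 1)) = √2 * √2 ^ i := by
      rw [show √((2 : ℝ) ^ (i + 1)) = √2 ^ (i + 1) by
        rw [Real.sqrt_eq_iff_mul_self_eq (by positivity) (by positivity), ← mul_pow, hs2]]
      ring
    rw [hp, mul_div_assoc √2, ← div_pow]
    have : √2 / 2 ≤ (3 / 4 : ℝ) := by linarith
    push_cast
    gcongr
  calc levelWidth N δ (i + 1) / 2 ^ i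
      = etaConc (2 ^ (i + 1) * ((i + 1 : ℕ) : ℝ) ^ 2 * MFCP N / δ) *
        (√(((i + 1 : ℕ) : ℝ) ^ 2 * 2 ^ (i + 1) / N) / 2 ^ i) := by
        unfold levelWidth; ring
    _ ≤ 4 * (√l * (((i : ℝ) + 3) / 2)) *
        (((i : ℝ) + 1) * ((3 / 2) * (3 / 4) ^ i) / √(N : ℝ)) := by gcongr
    _ = _ := by ring

theorem sum_weights_le (n : ℕ) :
    ∑ i ∈ Finset.Icc 1 n, (((i : ℝ) + 1) * (i + 3) / 2 * (3 / 4) ^ i) ≤ 71 := by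
  have : ∑ i ∈ Finset.Icc 1 n, (((i : ℝ) + 1) * (i + 3) / 2 * (3 / 4) ^ i) =
      141 / 2 - (3 / 2 * (n : ℝ) ^ 2 + 18 * n + 141 / 2) * (3 / 4) ^ n := by
    induction n with
    | zero => simp
    | succ n ih =>
      rw [Finset.sum_Icc_succ_top (by omega), ih]
      push_cast
      ring
  rw [this]
  have : 0 ≤ (3 / 2 * (n : ℝ) ^ 2 + 18 * n + 141 / 2) * (3 / 4) ^ n := by positivity
  linarith

end

/-! ### The peeling argument -/

/-- Descend from `n + 1` to the first `i` with `t i ≤ w`: there `w ≤ t (i + 1)`, so a single term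
suffices. If there is none, `w ≤ t 1`. Monotonicity of `t` plays no role. -/
theorem le_add_sum_of_le {t : ℕ → ℝ} (ht : ∀ i, 0 ≤ t i) (w : ℝ) (n : ℕ) (hw : w ≤ t (n + 1)) :
    w ≤ t 1 + ∑ i ∈ Finset.Icc 1 n, t (i + 1) * (Set.Ici (t i)).indicator 1 w := by
  induction n with
  | zero => simpa using hw
  | succ n ih =>
    rw [Finset.sum_Icc_succ_top (by omega)]
    by_cases h : t (n + 1) ≤ w
    · have h1 : 0 ≤ ∑ i ∈ Finset.Icc 1 n, t (i + 1) * (Set.Ici (t i)).indicator (1 : ℝ → ℝ) w :=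
        Finset.sum_nonneg fun i _ => mul_nonneg (ht _)
          (Set.indicator_nonneg (fun _ _ => zero_le_one) _)
      rw [Set.indicator_of_mem (show w ∈ Set.Ici (t (n + 1)) from h)]
      have := ht 1
      simp only [Pi.one_apply, mul_one]
      linarith
    · have := ih (not_le.1 h).le
      rw [Set.indicator_of_notMem (show w ∉ Set.Ici (t (n + 1)) from h)]
      linarith

theorem integral_le_peeling {α : Type*} [MeasurableSpace α] {μ : Measure α} [IsProbabilityMeasure μ]
    {Y : α → ℝ} (hY : Measurable Y) (hint : Integrable Y μ) {t : ℕ → ℝ} (ht : ∀ i, 0 ≤ t i) (b : ℝ)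
    (n : ℕ) (hle : ∀ᵐ a ∂μ, Y a ≤ b + t (n + 1)) :
    ∫ a, Y a ∂μ ≤ b + t 1 + ∑ i ∈ Finset.Icc 1 n, t (i + 1) * μ.real {a | b + t i ≤ Y a} := by
  have hms : ∀ i, MeasurableSet {a | b + t i ≤ Y a} := fun i => measurableSet_le (by fun_prop) hY
  have hind : ∀ i, Integrable (fun a => t (i + 1) * {a | b + t i ≤ Y a}.indicator (1 : α → ℝ) a) μ :=
    fun i => ((integrable_const (1 : ℝ)).indicator (hms i)).const_mul _
  have hsum := integrable_finsetSum (Finset.Icc 1 n) fun i _ => hind i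
  calc ∫ a, Y a ∂μ
      ≤ ∫ a, ((b + t 1) + ∑ i ∈ Finset.Icc 1 n,
          t (i + 1) * {a | b + t i ≤ Y a}.indicator (1 : α → ℝ) a) ∂μ := by
        refine integral_mono_ae hint ((integrable_const _).add hsum) ?_
        filter_upwards [hle] with a ha
        have := le_add_sum_of_le ht (Y a - b) n (by linarith)
        have e : ∀ i, (Set.Ici (t i)).indicator (1 : ℝ → ℝ) (Y a - b) =
            {a | b + t i ≤ Y a}.indicator (1 : α → ℝ) a := by
          intro i
          by_cases h : b + t i ≤ Y a
          · rw [Set.indicator_of_mem (show a ∈ {a | b + t i ≤ Y a} from h),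
              Set.indicator_of_mem (show Y a - b ∈ Set.Ici (t i) by simp; linarith)]
            rfl
          · rw [Set.indicator_of_notMem (show a ∉ {a | b + t i ≤ Y a} from h),
              Set.indicator_of_notMem (show Y a - b ∉ Set.Ici (t i) by simp at h ⊢; linarith)]
        simp only [e] at this
        linarith
    _ = _ := by
        rw [integral_add (integrable_const _) hsum, integral_finsetSum _ fun i _ => hind i]
        simp only [integral_const, probReal_univ, one_smul, integral_const_mul,
          integral_indicator_one (hms _)]

/-- If every observed level were light, peeling with `t i = 6 * levelWidth N δ i` would bound the
mean by the offset `≤ D/16 + 1/(16 √N)`, plus the first width, plus a convergent series of order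
`l^(3/2) / √N`. The lower bound on `D` makes this less than `D / 8`. -/
theorem exists_heavy_level {α : Type*} [MeasurableSpace α] {μ : Measure α} [IsProbabilityMeasure μ]
    {N : ℕ} {δ : ℝ} (hN : 1 ≤ N) (hδ : 0 < δ) (hδ4 : δ < 1 / 4)
    {Y : α → ℝ} (hY : Measurable Y) (hint : Integrable Y μ) (hY1 : ∀ᵐ a ∂μ, Y a ≤ 1) {D : ℝ} {s : ℕ}
    (hDs : ((17 / 16 : ℝ) ^ s - 1) / N ≤ D) (hDY : (1 / 8) * D < ∫ a, Y a ∂μ)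
    (hD : 2 ^ 15 * etaConc (MFCP N / δ) * Real.log (2 * MFCP N / δ) * (1 / √(N : ℝ)) < D) :
    ∃ i ∈ Finset.Icc 1 (Nat.log 2 N + 1), 0 < reps N i ∧
      Real.log (MFCP N / δ) / 2 ^ i <
        μ.real {a | (17 / 16 : ℝ) ^ s / (16 * N) + 6 * levelWidth N δ i ≤ Y a} := by
  have hM := twelve_le_MFCP hN
  have hN1 : (1 : ℝ) ≤ N := by exact_mod_cast hN
  have hex : ∃ n, reps N (n + 1) = 0 := by
    refine ⟨N, Nat.div_eq_of_lt ?_⟩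
    have : N + 1 < 2 ^ (N + 1) := Nat.lt_two_pow_self
    nlinarith [Nat.zero_le N]
  -- Level `n + 1` is the first without observations, so levels `1, ..., n` are all observed and
  -- level `n + 1` caps `Y`.
  classical
  set n := Nat.find hex
  have hn : reps N (n + 1) = 0 := Nat.find_spec hex
  have hpos : ∀ i ∈ Finset.Icc 1 n, 0 < reps N i := by
    intro i hi
    rw [Finset.mem_Icc] at hi
    have := Nat.find_min hex (m := i - 1) (by omega)
    rw [Nat.sub_add_cancel hi.1] at this
    omega
  by_contra! hcon
  have hsmall : ∀ i ∈ Finset.Icc 1 n,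
      μ.real {a | (17 / 16 : ℝ) ^ s / (16 * N) + 6 * levelWidth N δ i ≤ Y a} ≤
        Real.log (MFCP N / δ) / 2 ^ i := by
    intro i hi
    have hp := hpos i hi
    rw [Finset.mem_Icc] at hi
    refine hcon i (Finset.mem_Icc.2 ⟨hi.1, ?_⟩) hp
    have h1 : 2 ^ i * i ^ 2 ≤ N := by
      by_contra h
      exact hp.ne' (Nat.div_eq_of_lt (not_le.1 h))
    have h2 : 2 ^ i ≤ N := le_trans (Nat.le_mul_of_pos_right _ (by have := hi.1; positivity)) h1
    have := Nat.le_log_of_pow_le (by norm_num) h2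
    omega
  have h4 := four_le_log hN hδ hδ4
  have hLl : Real.log (MFCP N / δ) ≤ Real.log (2 * MFCP N / δ) := by
    apply Real.log_le_log (by positivity)
    gcongr
    linarith
  have hL0 : 0 ≤ Real.log (MFCP N / δ) := by
    apply Real.log_nonneg
    rw [le_div_iff₀ hδ]
    linarith
  have hw1 := one_le_levelWidth_of_reps_eq_zero hN hδ hδ4 (by omega) hn
  have hb : 0 ≤ (17 / 16 : ℝ) ^ s / (16 * N) := by positivity
  have hpeel := integral_le_peeling (t := fun i => 6 * levelWidth N δ i) hY hint
    (fun i => mul_nonneg (by norm_num) (levelWidth_nonneg N δ i)) ((17 / 16 : ℝ) ^ s / (16 * N)) n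
    (by filter_upwards [hY1] with a ha; linarith)
  have hfirst := levelWidth_succ_le hN hδ hδ4 0
  rw [etaConc, ← mul_div_assoc 2] at hD
  set l := Real.log (2 * MFCP N / δ)
  set L := Real.log (MFCP N / δ)
  have hsum : ∑ i ∈ Finset.Icc 1 n, 6 * levelWidth N δ (i + 1) *
      μ.real {a | (17 / 16 : ℝ) ^ s / (16 * N) + 6 * levelWidth N δ i ≤ Y a} ≤
      6 * l * (6 * √l / √(N : ℝ)) * 71 := by
    calc _ ≤ ∑ i ∈ Finset.Icc 1 n, 6 * l * (6 * √l / √(N : ℝ)) *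
          (((i : ℝ) + 1) * (i + 3) / 2 * (3 / 4) ^ i) := by
          refine Finset.sum_le_sum fun i hi => ?_
          have h1 := levelWidth_nonneg N δ (i + 1)
          calc _ ≤ 6 * levelWidth N δ (i + 1) * (l / 2 ^ i) := by
                gcongr
                exact (hsmall i hi).trans (by gcongr)
            _ = 6 * l * (levelWidth N δ (i + 1) / 2 ^ i) := by ring
            _ ≤ 6 * l * (6 * √l / √(N : ℝ) *
                (((i : ℝ) + 1) * (i + 3) / 2 * (3 / 4) ^ i)) := by
                gcongr
                exact levelWidth_succ_le hN hδ hδ4 i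
            _ = _ := by ring
      _ ≤ _ := by
          rw [← Finset.mul_sum]
          gcongr
          exact sum_weights_le n
  -- The first term of the threshold is `1/16` of the gain so far, up to the leftover `1 / (16 N)`.
  have hbD : (17 / 16 : ℝ) ^ s / (16 * N) ≤ D / 16 + 1 / (16 * √(N : ℝ)) := by
    have hs : √(N : ℝ) ≤ N := by
      rw [Real.sqrt_le_left (by linarith)]; nlinarith
    have hs0 : 0 < √(N : ℝ) := Real.sqrt_pos.2 (by linarith)
    have h1 : (17 / 16 : ℝ) ^ s / (16 * N) = ((17 / 16 : ℝ) ^ s - 1) / N / 16 + 1 / (16 * N) := by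
      field_simp; ring
    have h2 : 1 / (16 * (N : ℝ)) ≤ 1 / (16 * √(N : ℝ)) := by gcongr
    rw [h1]
    linarith
  have hs0 : 0 < √(N : ℝ) := Real.sqrt_pos.2 (by linarith)
  have hl1 : 1 ≤ √l := Real.one_le_sqrt.2 (by linarith)
  have hA : 4 ≤ l * √l := by nlinarith
  have hA' : √l ≤ l * √l / 4 := by nlinarith
  -- In units of `A / √N`, the contributions are `2556` from the levels, at most `54` from the first
  -- width and at most `1` from the leftover, while `D / 16` exceeds `2^13`.
  set A := l * √l
  have e1 : 6 * l * (6 * √l / √(N : ℝ)) * 71 = 2556 * (A / √(N : ℝ)) := by simp only [A]; ring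
  have e2 : (2 : ℝ) ^ 15 * (4 * √l) * l * (1 / √(N : ℝ)) = 2 ^ 17 * (A / √(N : ℝ)) := by
    simp only [A]; ring
  have e3 : 1 / (16 * √(N : ℝ)) ≤ A / √(N : ℝ) := by
    rw [div_le_div_iff₀ (by positivity) hs0]; nlinarith
  have e4 : 6 * levelWidth N δ (0 + 1) ≤ 54 * (A / √(N : ℝ)) := by
    have h5 : √l / √(N : ℝ) ≤ A / 4 / √(N : ℝ) := by gcongr
    have h6 : A / 4 / √(N : ℝ) = A / √(N : ℝ) / 4 := by ring
    have h7 : 6 * √l / √(N : ℝ) = 6 * (√l / √(N : ℝ)) := by ring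
    norm_num at hfirst ⊢
    have h8 : 0 ≤ A / √(N : ℝ) := by positivity
    linarith
  rw [e1] at hsum
  rw [e2] at hD
  simp only [zero_add] at e4
  linarith

/-! ### Product measures -/

theorem measurable_measure_pi {ι S Y : Type*} [Fintype ι] [MeasurableSpace S] [MeasurableSpace Y]
    {κ : ι → S → Measure Y} [∀ i s, IsProbabilityMeasure (κ i s)] (h : ∀ i, Measurable (κ i)) :
    Measurable (fun s => Measure.pi (fun i => κ i s)) := by
  refine Measurable.measure_of_isPiSystem_of_isProbabilityMeasure generateFrom_pi.symm
    isPiSystem_pi ?_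
  rintro _ ⟨B, hB, rfl⟩
  simp only [Measure.pi_pi]
  exact Finset.measurable_prod _ fun i _ =>
    (Measure.measurable_coe (hB i (Set.mem_univ i))).comp (h i)

/-- A conditional bound uniform in the history integrates to the same bound. The laws are prescribed
only on `A` and for fixed `B`; agreement on rectangles extends them to events `C` that involve the
history and the new sample jointly. -/
theorem measure_joint_le {Ω S Y : Type*} [MeasurableSpace Ω] [MeasurableSpace S]
    [MeasurableSpace Y] {P : Measure Ω} [IsProbabilityMeasure P] {A : Set Ω}
    {H : Ω → S} (hH : Measurable H) {Z : Ω → Y} (hZ : Measurable Z)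
    (κ : Kernel S Y) [IsMarkovKernel κ]
    (hlaw : ∀ D B, MeasurableSet D → MeasurableSet B →
      P (A ∩ H ⁻¹' D ∩ Z ⁻¹' B) = ∫⁻ ω in A ∩ H ⁻¹' D, κ (H ω) B ∂P)
    {C : Set (S × Y)} (hC : MeasurableSet C) {ε : ℝ≥0∞}
    (hε : ∀ h, κ h (Prod.mk h ⁻¹' C) ≤ ε) :
    P (A ∩ {ω | (H ω, Z ω) ∈ C}) ≤ ε := by
  have hHZ : Measurable fun ω => (H ω, Z ω) := hH.prodMk hZ
  have key : (P.restrict A).map (fun ω => (H ω, Z ω)) = ((P.restrict A).map H) ⊗ₘ κ := by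
    have hfin : IsFiniteMeasure ((P.restrict A).map H) := Measure.isFiniteMeasure_map _ _
    have hfin' : IsFiniteMeasure ((P.restrict A).map fun ω => (H ω, Z ω)) :=
      Measure.isFiniteMeasure_map _ _
    refine Measure.ext_prod fun {D B} hD hB => ?_
    rw [Measure.map_apply hHZ (hD.prod hB), Measure.compProd_apply_prod hD hB,
      Measure.restrict_apply (hHZ (hD.prod hB)), setLIntegral_map hD (κ.measurable_coe hB) hH,
      Measure.restrict_restrict (hH hD), Set.inter_comm (H ⁻¹' D), ← hlaw D B hD hB]
    congr 1
    ext ω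
    simp only [Set.mem_inter_iff, Set.mem_preimage, Set.mem_prod]
    tauto
  calc P (A ∩ {ω | (H ω, Z ω) ∈ C})
      = ((P.restrict A).map (fun ω => (H ω, Z ω))) C := by
        rw [Measure.map_apply hHZ hC, Measure.restrict_apply (hHZ hC), Set.inter_comm]
        rfl
    _ = ∫⁻ h, κ h (Prod.mk h ⁻¹' C) ∂((P.restrict A).map H) := by
        rw [key, Measure.compProd_apply hC]
    _ ≤ ∫⁻ _h, ε ∂((P.restrict A).map H) := lintegral_mono fun h => hε h
    _ ≤ ε := by
        rw [lintegral_const, Measure.map_apply hH MeasurableSet.univ, Set.preimage_univ,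
          Measure.restrict_apply_univ]
        exact mul_le_of_le_one_right' prob_le_one

/-- The event is a box with `2^i` nontrivial sides, and `1 - x ≤ exp (-x)`. -/
theorem pi_miss_le {α : Type*} [MeasurableSpace α] {N : ℕ} (μ : Measure α) [IsProbabilityMeasure μ]
    (i : levels N) {G : Set α} (hG : MeasurableSet G) :
    (Measure.pi fun _ : Cand N => μ) {p | ∀ j, p ⟨i, j⟩ ∉ G} ≤
      ENNReal.ofReal (Real.exp (-(2 ^ (i : ℕ) * μ.real G))) := by
  classical
  have hset : {p : Cand N → α | ∀ j, p ⟨i, j⟩ ∉ G} =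
      Set.univ.pi fun q : Cand N => if q.1 = i then Gᶜ else Set.univ := by
    ext p
    simp only [Set.mem_ofPred_eq, Set.mem_pi, Set.mem_univ, true_imp_iff]
    constructor
    · rintro h ⟨k, j⟩
      by_cases hk : k = i
      · subst hk; simpa using h j
      · simp [hk]
    · intro h j
      simpa using h ⟨i, j⟩
  have hm : ∀ q : Cand N, μ (if q.1 = i then Gᶜ else Set.univ) =
      if q.1 = i then μ Gᶜ else 1 := by
    intro q
    split_ifs <;> simp
  have hprod : ∏ q : Cand N, (if q.1 = i then μ Gᶜ else 1) = μ Gᶜ ^ (2 ^ (i : ℕ)) := by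
    rw [Fintype.prod_sigma, Finset.prod_eq_single i]
    · simp
    · intro k _ hk; simp [hk]
    · simp
  have hc : μ Gᶜ = ENNReal.ofReal (1 - μ.real G) := by
    rw [← probReal_compl_eq_one_sub hG, ofReal_measureReal]
  rw [hset, Measure.pi_pi]
  simp only [hm, hprod]
  rw [hc, ← ENNReal.ofReal_pow (by linarith [measureReal_le_one (μ := μ) (s := G)])]
  apply ENNReal.ofReal_le_ofReal
  calc (1 - μ.real G) ^ 2 ^ (i : ℕ) ≤ Real.exp (-μ.real G) ^ 2 ^ (i : ℕ) := by
        apply pow_le_pow_left₀ (by linarith [measureReal_le_one (μ := μ) (s := G)])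
        have := Real.add_one_le_exp (-μ.real G)
        linarith
    _ = _ := by rw [← Real.exp_nat_mul]; push_cast; ring_nf

/-! ### Concentration of empirical means -/

section
variable {ι : Type*} [Fintype ι] {μ : ι → Measure ℝ≥0∞} [∀ i, IsProbabilityMeasure (μ i)]

theorem ae_pi_le_one (h1 : ∀ i, ∀ᵐ y ∂μ i, y ≤ 1) : ∀ᵐ y ∂Measure.pi μ, ∀ i, y i ≤ 1 :=
  Filter.eventually_all.2 fun i =>
    (Measure.quasiMeasurePreserving_eval μ i).ae (h1 i)

/-- Two-sided Hoeffding: a variable in `[0, 1]` is sub-Gaussian with parameter `1/4`. -/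
theorem pi_abs_sum_sub_gt_le (h1 : ∀ i, ∀ᵐ y ∂μ i, y ≤ 1) {m : ℝ} (hm : 0 ≤ m) (T : Finset ι)
    (hmean : ∀ i ∈ T, ∫⁻ y, y ∂μ i = ENNReal.ofReal m) {t : ℝ} (ht : 0 ≤ t) (hT : 0 < T.card) :
    (Measure.pi μ).real {y | T.card * t < |∑ i ∈ T, ((y i).toReal - m)|} ≤
      2 * Real.exp (-2 * T.card * t ^ 2) := by
  classical
  have hmean' : ∀ i ∈ T, ∫ y, y.toReal ∂μ i = m := by
    intro i hi
    have hlt : ∀ᵐ y ∂μ i, y < ∞ := by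
      filter_upwards [h1 i] with y hy
      exact hy.trans_lt ENNReal.one_lt_top
    rw [integral_toReal (f := fun y => y) aemeasurable_id hlt, hmean i hi, ENNReal.toReal_ofReal hm]
  have hsub : ∀ i ∈ T, HasSubgaussianMGF (fun y : ι → ℝ≥0∞ => (y i).toReal - m)
      ((‖(1 : ℝ) - 0‖₊ / 2) ^ 2) (Measure.pi μ) := by
    intro i hi
    have h := hasSubgaussianMGF_of_mem_Icc (μ := Measure.pi μ)
      (X := fun y : ι → ℝ≥0∞ => (y i).toReal) (a := 0) (b := 1)
      (measurable_pi_apply i).ennreal_toReal.aemeasurable (by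
        filter_upwards [ae_pi_le_one h1] with y hy
        exact ⟨ENNReal.toReal_nonneg, ENNReal.toReal_le_of_le_ofReal zero_le_one
          (by simpa using hy i)⟩)
    have e : ∫ y : ι → ℝ≥0∞, (y i).toReal ∂Measure.pi μ = m := by
      rw [← hmean' i hi, ← (measurePreserving_eval μ i).map_eq,
        integral_map (measurable_pi_apply i).aemeasurable]
      exact measurable_id.ennreal_toReal.aestronglyMeasurable
    rwa [e] at h
  have hind : iIndepFun (fun i (y : ι → ℝ≥0∞) => (y i).toReal - m) (Measure.pi μ) :=
    iIndepFun_pi (X := fun _ (y : ℝ≥0∞) => y.toReal - m)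
      fun i => (measurable_id.ennreal_toReal.sub_const m).aemeasurable
  have hind' : iIndepFun (fun i (y : ι → ℝ≥0∞) => -((y i).toReal - m)) (Measure.pi μ) :=
    iIndepFun_pi (X := fun _ (y : ℝ≥0∞) => -(y.toReal - m))
      fun i => (measurable_id.ennreal_toReal.sub_const m).neg.aemeasurable
  have hexp : -(T.card * t) ^ 2 / (2 * ((∑ _i ∈ T, (‖(1 : ℝ) - 0‖₊ / 2) ^ 2 : NNReal) : ℝ)) =
      -2 * T.card * t ^ 2 := by
    have : (T.card : ℝ) ≠ 0 := by exact_mod_cast hT.ne'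
    simp
    field_simp
  have b1 := HasSubgaussianMGF.measure_sum_ge_le_of_iIndepFun hind hsub
    (ε := T.card * t) (by positivity)
  have b2 := HasSubgaussianMGF.measure_sum_ge_le_of_iIndepFun hind'
    (c := fun _ => (‖(1 : ℝ) - 0‖₊ / 2) ^ 2) (fun i hi => (hsub i hi).neg)
    (ε := T.card * t) (by positivity)
  rw [hexp] at b1 b2
  calc _ ≤ (Measure.pi μ).real ({y | T.card * t ≤ ∑ i ∈ T, ((y i).toReal - m)} ∪
        {y | T.card * t ≤ ∑ i ∈ T, -((y i).toReal - m)}) := by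
        refine measureReal_mono ?_
        intro y hy
        rw [Set.mem_ofPred_eq] at hy
        rcases lt_abs.1 hy with h | h
        · exact Or.inl h.le
        · refine Or.inr ?_
          rw [Set.mem_ofPred_eq, Finset.sum_neg_distrib]
          exact h.le
    _ ≤ _ := measureReal_union_le _ _
    _ ≤ _ := by linarith

theorem pi_abs_mean_sub_gt_le (h1 : ∀ i, ∀ᵐ y ∂μ i, y ≤ 1) {m : ℝ} (hm : 0 ≤ m) {n : ℕ} (hn : 0 < n)
    {e : Fin n → ι} (he : Function.Injective e)
    (hmean : ∀ k, ∫⁻ y, y ∂μ (e k) = ENNReal.ofReal m) {t : ℝ} (ht : 0 ≤ t) :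
    Measure.pi μ {y | t < |((∑ k, y (e k)) / n).toReal - m|} ≤
      ENNReal.ofReal (2 * Real.exp (-2 * n * t ^ 2)) := by
  classical
  have h := pi_abs_sum_sub_gt_le h1 hm (Finset.univ.map ⟨e, he⟩) (by simpa using hmean) ht (by simpa)
  simp only [Finset.card_map, Finset.card_univ, Fintype.card_fin, Finset.sum_map,
    Function.Embedding.coeFn_mk] at h
  have hn0 : (0 : ℝ) < n := by exact_mod_cast hn
  rw [← ofReal_measureReal]
  apply ENNReal.ofReal_le_ofReal
  refine le_trans (ENNReal.toReal_mono (measure_ne_top _ _) (measure_mono_ae ?_)) h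
  filter_upwards [ae_pi_le_one h1] with y hy hty
  change (n : ℝ) * t < |∑ k, ((y (e k)).toReal - m)|
  change t < |((∑ k, y (e k)) / n).toReal - m| at hty
  rw [ENNReal.toReal_div, ENNReal.toReal_sum fun k _ => ((hy _).trans_lt ENNReal.one_lt_top).ne,
    ENNReal.toReal_natCast] at hty
  have : ∑ k, ((y (e k)).toReal - m) = n * ((∑ k, (y (e k)).toReal) / n - m) := by
    rw [Finset.sum_sub_distrib]
    simp
    field_simp
  rw [this, abs_mul, abs_of_pos hn0]
  gcongr

end

/-! ### One round -/

/-- The guarantee on the returned point `z`: either the smoothed function is flat around `z`, or `z`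
is nearly optimal. -/
def FlatOrNearOptimal {d : ℕ} (Xbar : Set (E d)) (f : E d → ℝ) (X : Set (E d)) (xstar : E d)
    (c : ℝ) (N : ℕ) (δ : ℝ) (z : E d) : Prop :=
  (smooth Xbar f X (2 * c) z ≠ ∞ ∧ smooth Xbar f X c z ≠ ∞ ∧
      (smooth Xbar f X (2 * c) z).toReal - (smooth Xbar f X c z).toReal
        ≤ (1 / 2 ^ 3) * ((smooth Xbar f X c z).toReal - f xstar)) ∨
    (g Xbar f X z ≠ ∞ ∧
      (g Xbar f X z).toReal - f xstar
        ≤ 2 ^ 15 * etaConc (MFCP N / δ) * Real.log (2 * MFCP N / δ) * (1 / √(N : ℝ)))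

/-- No observed candidate improves on `z` by the threshold of round `s` plus twice the width of its
confidence interval. -/
def NoImprovingCand {d N : ℕ} (Xbar : Set (E d)) (f : E d → ℝ) (X : Set (E d)) (δ : ℝ) (s : ℕ)
    (z : E d) (p : Cand N → E d) : Prop :=
  ∀ q : Cand N, 0 < reps N q.1 →
    gReal Xbar f X (p q) < gReal Xbar f X z +
      ((17 / 16 : ℝ) ^ s / (16 * N) + 6 * levelWidth N δ q.1)

/-- All the estimates of a round are finite and within their confidence intervals. -/
def EstimatesAccurate {d N : ℕ} (Xbar : Set (E d)) (f : E d → ℝ) (X : Set (E d)) (δ : ℝ)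
    (z : E d) (p : Cand N → E d) (y : Query N → ℝ≥0∞) : Prop :=
  (centerEst y ≠ ∞ ∧
      |gReal Xbar f X z - (centerEst y).toReal| ≤ etaConc (MFCP N / δ) / √(N : ℝ)) ∧
    ∀ q : Cand N, 0 < reps N q.1 → candEst y q ≠ ∞ ∧
      |gReal Xbar f X (p q) - (candEst y q).toReal| ≤ levelWidth N δ q.1

/-! ### Measurability of the events of one round -/

section measurability
variable {d N : ℕ} {Xbar X : Set (E d)} {f : E d → ℝ} {κ : Kernel (E d) ℝ≥0∞} {δ : ℝ}

theorem measurable_centerEst : Measurable (centerEst (N := N)) := by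
  unfold centerEst
  fun_prop

theorem measurable_candEst (q : Cand N) : Measurable fun y => candEst y q := by
  unfold candEst
  fun_prop

theorem measurableSet_eligible (s : ℕ) (q : Cand N) : MeasurableSet {y | Eligible δ s y q} := by
  have h1 : MeasurableSet {y : Query N → ℝ≥0∞ |
      ENNReal.ofReal (threshold N δ s q.1) ≤ candEst y q - centerEst y} :=
    measurableSet_le measurable_const ((measurable_candEst q).sub measurable_centerEst)
  exact (MeasurableSet.const _).inter h1

theorem measurableSet_flatOrNearOptimal (hκ : IsObservationKernel Xbar f κ) (xstar : E d) {c : ℝ}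
    (hc : 0 < c) : MeasurableSet {z | FlatOrNearOptimal Xbar f X xstar c N δ z} := by
  have h1 := measurable_smooth (X := X) hκ hc
  have h2 := measurable_smooth (X := X) hκ (show 0 < 2 * c by positivity)
  have h3 := measurable_g (X := X) hκ
  refine MeasurableSet.union ?_ ?_
  · refine MeasurableSet.inter ?_ (MeasurableSet.inter ?_ ?_)
    · exact (measurableSet_eq_fun h2 measurable_const).compl
    · exact (measurableSet_eq_fun h1 measurable_const).compl
    · exact measurableSet_le (h2.ennreal_toReal.sub h1.ennreal_toReal)
        ((h1.ennreal_toReal.sub_const _).const_mul _)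
  · exact (measurableSet_eq_fun h3 measurable_const).compl.inter
      (measurableSet_le (h3.ennreal_toReal.sub_const _) measurable_const)

theorem measurableSet_noImprovingCand (hκ : IsObservationKernel Xbar f κ) (s : ℕ) :
    MeasurableSet {a : E d × (Cand N → E d) | NoImprovingCand Xbar f X δ s a.1 a.2} := by
  have h := measurable_gReal (X := X) hκ
  have : {a : E d × (Cand N → E d) | NoImprovingCand Xbar f X δ s a.1 a.2} =
      ⋂ q : Cand N, ⋂ _ : 0 < reps N q.1, {a | gReal Xbar f X (a.2 q) < gReal Xbar f X a.1 +
      ((17 / 16 : ℝ) ^ s / (16 * N) + 6 * levelWidth N δ q.1)} := by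
    ext a; simp [NoImprovingCand]
  rw [this]
  exact MeasurableSet.iInter fun q => MeasurableSet.iInter fun _ =>
    measurableSet_lt (h.comp ((measurable_pi_apply q).comp measurable_snd))
      ((h.comp measurable_fst).add_const _)

theorem measurableSet_estimatesAccurate (hκ : IsObservationKernel Xbar f κ) :
    MeasurableSet {a : (E d × (Cand N → E d)) × (Query N → ℝ≥0∞) |
      EstimatesAccurate Xbar f X δ a.1.1 a.1.2 a.2} := by
  have h := measurable_gReal (X := X) hκ
  refine MeasurableSet.inter (MeasurableSet.inter ?_ ?_) ?_
  · exact (measurableSet_eq_fun (measurable_centerEst.comp measurable_snd) measurable_const).compl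
  · have hm : Measurable fun a : (E d × (Cand N → E d)) × (Query N → ℝ≥0∞) =>
        gReal Xbar f X a.1.1 - (centerEst a.2).toReal :=
      (h.comp (measurable_fst.comp measurable_fst)).sub
        (measurable_centerEst.comp measurable_snd).ennreal_toReal
    exact measurableSet_le hm.abs measurable_const
  · have : {a : (E d × (Cand N → E d)) × (Query N → ℝ≥0∞) | ∀ q : Cand N, 0 < reps N q.1 →
        candEst a.2 q ≠ ∞ ∧
        |gReal Xbar f X (a.1.2 q) - (candEst a.2 q).toReal| ≤ levelWidth N δ q.1} =
        ⋂ q : Cand N, ⋂ _ : 0 < reps N q.1, ({a | candEst a.2 q = ∞}ᶜ ∩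
        {a | |gReal Xbar f X (a.1.2 q) - (candEst a.2 q).toReal| ≤ levelWidth N δ q.1}) := by
      ext a; simp
    change MeasurableSet {a : (E d × (Cand N → E d)) × (Query N → ℝ≥0∞) |
      ∀ q : Cand N, 0 < reps N q.1 → candEst a.2 q ≠ ∞ ∧
        |gReal Xbar f X (a.1.2 q) - (candEst a.2 q).toReal| ≤ levelWidth N δ q.1}
    rw [this]
    refine MeasurableSet.iInter fun q => MeasurableSet.iInter fun _ => MeasurableSet.inter ?_ ?_
    · exact (measurableSet_eq_fun ((measurable_candEst q).comp measurable_snd)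
        measurable_const).compl
    · have hm : Measurable fun a : (E d × (Cand N → E d)) × (Query N → ℝ≥0∞) =>
          gReal Xbar f X (a.1.2 q) - (candEst a.2 q).toReal :=
        (h.comp ((measurable_pi_apply q).comp (measurable_snd.comp measurable_fst))).sub
          ((measurable_candEst q).comp measurable_snd).ennreal_toReal
      exact measurableSet_le hm.abs measurable_const

end measurability

/-- A heavy level contains an improving candidate unless all its `2^i` draws miss, which has
probability at most `exp (-log (M/δ)) = δ / M`. -/
theorem pi_noImprovingCand_le {d N : ℕ} {Xbar X : Set (E d)} {f : E d → ℝ}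
    {κ : Kernel (E d) ℝ≥0∞} {δ : ℝ} (hκ : IsObservationKernel Xbar f κ)
    (hf01 : ∀ x ∈ Xbar, f x ∈ Set.Icc (0 : ℝ) 1) (hf : ConvexOn ℝ Xbar f) (xstar : E d)
    {c : ℝ} (hc : 0 < c)
    (hN : 1 ≤ N) (hδ : 0 < δ) (hδ4 : δ < 1 / 4) {z : E d} {s : ℕ}
    (hz : ∀ u ∈ closedBall z (2 * c), toX X u ∈ Xbar)
    (hs : ((17 / 16 : ℝ) ^ s - 1) / N ≤ gReal Xbar f X z - f xstar)
    (hnot : ¬ FlatOrNearOptimal Xbar f X xstar c N δ z) :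
    Measure.pi (fun _ : Cand N => unif (closedBall z (2 * c)))
      {p | NoImprovingCand Xbar f X δ s z p} ≤ ENNReal.ofReal (δ / MFCP N) := by
  have hM := twelve_le_MFCP hN
  have h2c : 0 < 2 * c := by positivity
  have hzc : ∀ u ∈ closedBall z c, toX X u ∈ Xbar :=
    fun u hu => hz u (closedBall_subset_closedBall (by linarith) hu)
  have hz0 : toX X z ∈ Xbar := hz z (mem_closedBall_self h2c.le)
  have hprob := isProbabilityMeasure_unif z h2c
  have hint := integrable_gReal hκ hf01 h2c hz
  have hmeas := measurable_gReal (X := X) hκ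
  unfold FlatOrNearOptimal at hnot
  push Not at hnot
  obtain ⟨hn1, hn2⟩ := hnot
  have hflat := hn1 (smooth_ne_top hκ hf01 h2c hz) (smooth_ne_top hκ hf01 hc hzc)
  have hopt := hn2 (g_ne_top hz0)
  have hle := gReal_le_toReal_smooth hκ hf01 hc hzc hf
  have hmeasY : Measurable fun u => gReal Xbar f X u - gReal Xbar f X z := hmeas.sub_const _
  obtain ⟨i, hi, hr, hlev⟩ := exists_heavy_level (μ := unif (closedBall z (2 * c))) hN hδ hδ4
    (Y := fun u => gReal Xbar f X u - gReal Xbar f X z) hmeasY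
    (hint.sub (integrable_const _)) (by
      filter_upwards [ae_mem_unif z (2 * c)] with u hu
      have h1 := (gReal_mem hf01 (hz u hu)).2
      have h0 := (gReal_mem hf01 hz0).1
      linarith) hs (by
      -- `g_{2c} - g ≥ g_{2c} - g_c > (g_c - f*)/8 ≥ (g - f*)/8`, using `g ≤ g_c` at both ends.
      rw [integral_sub hint (integrable_const _), ← toReal_smooth hκ hf01 h2c hz]
      simp only [integral_const, probReal_univ, one_smul]
      linarith) hopt
  set G := {u | (17 / 16 : ℝ) ^ s / (16 * N) + 6 * levelWidth N δ i ≤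
    gReal Xbar f X u - gReal Xbar f X z}
  refine (measure_mono ?_).trans ((pi_miss_le (unif (closedBall z (2 * c))) ⟨i, hi⟩ (G := G)
    (measurableSet_le measurable_const hmeasY)).trans ?_)
  · intro p hp j hj
    have h1 := hp ⟨⟨i, hi⟩, j⟩ hr
    have h2 : (17 / 16 : ℝ) ^ s / (16 * N) + 6 * levelWidth N δ i ≤
      gReal Xbar f X (p ⟨⟨i, hi⟩, j⟩) - gReal Xbar f X z := hj
    simp only at h1
    linarith
  · apply ENNReal.ofReal_le_ofReal
    rw [div_lt_iff₀' (by positivity)] at hlev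
    calc _ ≤ Real.exp (-Real.log (MFCP N / δ)) := Real.exp_le_exp.2 (by simpa using hlev.le)
      _ = δ / MFCP N := by
        rw [Real.exp_neg, Real.exp_log (div_pos (by linarith) hδ), inv_div]

/-- Of the two factors `2^(-i)`, one pays for the `2^i` candidates of the level and the other is
summed over the levels. -/
theorem exp_neg_levelWidth_le {N : ℕ} {δ : ℝ} (hN : 1 ≤ N) (hδ : 0 < δ) (hδ4 : δ < 1 / 4) {i : ℕ}
    (hi : 1 ≤ i) (hr : 0 < reps N i) :
    2 * Real.exp (-2 * reps N i * levelWidth N δ i ^ 2) ≤ δ / MFCP N * (1 / 2 ^ i) ^ 2 := by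
  have hM := twelve_le_MFCP hN
  have hN0 : (0 : ℝ) < N := by exact_mod_cast hN
  have hi1 : (1 : ℝ) ≤ i := by exact_mod_cast hi
  have h4 := four_le_log hN hδ hδ4
  have hge := levelLog_ge hN hδ hi
  -- A floor that is at least `1` is at least half of its argument.
  have hreps : (N : ℝ) ≤ 2 * reps N i * ((i : ℝ) ^ 2 * 2 ^ i) := by
    have h1 : N < (2 ^ i * i ^ 2) * (reps N i + 1) :=
      Nat.lt_mul_div_succ N (by positivity)
    have h2 : N ≤ 2 * reps N i * (i ^ 2 * 2 ^ i) := by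
      calc N ≤ (2 ^ i * i ^ 2) * (reps N i + 1) := h1.le
        _ ≤ (2 ^ i * i ^ 2) * (reps N i + reps N i) := Nat.mul_le_mul_left _ (by omega)
        _ = _ := by ring
    exact_mod_cast h2
  set lv := Real.log (2 * (2 ^ i * (i : ℝ) ^ 2 * MFCP N / δ)) with hlv
  have hw : levelWidth N δ i ^ 2 = 16 * lv * ((i : ℝ) ^ 2 * 2 ^ i / N) := by
    unfold levelWidth etaConc
    rw [mul_pow, mul_pow, Real.sq_sqrt (by linarith), Real.sq_sqrt (by positivity),
      show (4 : ℝ) ^ 2 = 16 by norm_num]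
  have hbig : 2 * lv ≤ 2 * reps N i * levelWidth N δ i ^ 2 := by
    rw [hw]
    have : 1 ≤ 2 * reps N i * ((i : ℝ) ^ 2 * 2 ^ i / N) := by
      rw [← mul_div_assoc, le_div_iff₀ hN0]; linarith
    nlinarith
  have hexp : Real.exp (-lv) = δ / MFCP N * (1 / 2 ^ i) / (2 * (i : ℝ) ^ 2) := by
    have : 0 < 2 * (2 ^ i * (i : ℝ) ^ 2 * MFCP N / δ) := by positivity
    rw [Real.exp_neg, hlv, Real.exp_log this]
    field_simp
  have hq1 : δ / MFCP N ≤ 1 := by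
    rw [div_le_one (by linarith)]; linarith
  have hq0 : 0 < δ / MFCP N := by positivity
  have hexp' : Real.exp (-lv) ≤ δ / MFCP N * (1 / 2 ^ i) / 2 := by
    rw [hexp]
    gcongr
    nlinarith
  calc 2 * Real.exp (-2 * reps N i * levelWidth N δ i ^ 2)
      ≤ 2 * Real.exp (-lv) ^ 2 := by
        rw [← Real.exp_nat_mul]
        refine mul_le_mul_of_nonneg_left (Real.exp_le_exp.2 ?_) zero_le_two
        push_cast
        linarith
    _ ≤ 2 * (δ / MFCP N * (1 / 2 ^ i) / 2) ^ 2 := by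
        gcongr
    _ = (δ / MFCP N) * (δ / MFCP N) * (1 / 2 ^ i) ^ 2 / 2 := by ring
    _ ≤ (δ / MFCP N) * 1 * (1 / 2 ^ i) ^ 2 / 1 := by gcongr; norm_num
    _ = _ := by ring

theorem exp_neg_centerWidth_le {N : ℕ} {δ : ℝ} (hN : 1 ≤ N) (hδ : 0 < δ) (hδ4 : δ < 1 / 4) :
    2 * Real.exp (-2 * N * (etaConc (MFCP N / δ) / √(N : ℝ)) ^ 2) ≤ δ / MFCP N := by
  have hM := twelve_le_MFCP hN
  have hN0 : (0 : ℝ) < N := by exact_mod_cast hN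
  have h4 := four_le_log hN hδ hδ4
  have e : -2 * N * (etaConc (MFCP N / δ) / √(N : ℝ)) ^ 2 = -32 * Real.log (2 * MFCP N / δ) := by
    unfold etaConc
    rw [← mul_div_assoc, div_pow, mul_pow, Real.sq_sqrt (by linarith), Real.sq_sqrt hN0.le]
    field_simp
    norm_num
  rw [e]
  calc _ ≤ 2 * Real.exp (-Real.log (2 * MFCP N / δ)) := by gcongr; linarith
    _ = δ / MFCP N := by
      rw [Real.exp_neg, Real.exp_log (by positivity)]
      field_simp

theorem sum_levels_le (N : ℕ) : ∑ i ∈ levels N, (1 / 2 : ℝ) ^ i ≤ 1 := by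
  have : ∀ n, ∑ i ∈ Finset.Icc 1 n, (1 / 2 : ℝ) ^ i = 1 - (1 / 2) ^ n := by
    intro n
    induction n with
    | zero => simp
    | succ n ih => rw [Finset.sum_Icc_succ_top (by omega), ih]; ring
  rw [levels, this]
  have : (0 : ℝ) ≤ (1 / 2) ^ (Nat.log 2 N + 1) := by positivity
  linarith

/-- Union bound at fixed query points: `δ / M` for the current point and `(δ / M) ∑ 2^i 4^(-i) ≤ δ /
M` for the candidates. -/
theorem pi_not_estimatesAccurate_le {d N : ℕ} {Xbar X : Set (E d)} {f : E d → ℝ}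
    {κ : Query N → Kernel (E d) ℝ≥0∞} {δ : ℝ} (hκ : ∀ a, IsObservationKernel Xbar f (κ a))
    (hf01 : ∀ x ∈ Xbar, f x ∈ Set.Icc (0 : ℝ) 1)
    (hN : 1 ≤ N) (hδ : 0 < δ) (hδ4 : δ < 1 / 4) {z : E d} {p : Cand N → E d}
    (hz : toX X z ∈ Xbar) (hp : ∀ q, toX X (p q) ∈ Xbar) :
    Measure.pi (fun a : Query N => κ a (toX X (queryPoint z p a)))
      {y | ¬ EstimatesAccurate Xbar f X δ z p y} ≤ ENNReal.ofReal (2 * (δ / MFCP N)) := by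
  classical
  have hM := twelve_le_MFCP hN
  have hmk := fun a => (hκ a).markov
  have hmem : ∀ a, toX X (queryPoint z p a) ∈ Xbar := by
    rintro (k | ⟨q, k⟩)
    · exact hz
    · exact hp q
  set μ : Query N → Measure ℝ≥0∞ := fun a => κ a (toX X (queryPoint z p a)) with hμ
  have h1 : ∀ a, ∀ᵐ y ∂μ a, y ≤ 1 := fun a => (hκ a).le_one _ (hmem a)
  have hmean : ∀ a, ∫⁻ y, y ∂μ a = ENNReal.ofReal (gReal Xbar f X (queryPoint z p a)) := by
    intro a
    rw [gReal_eq hf01 (hmem a)]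
    exact (hκ a).mean _ (hmem a)
  set w : Cand N → ℝ := fun q => levelWidth N δ q.1
  set S := Finset.univ.filter fun q : Cand N => 0 < reps N q.1
  set C : Set (Query N → ℝ≥0∞) := {y | etaConc (MFCP N / δ) / √(N : ℝ) <
    |((∑ k : Fin N, y (Sum.inl k)) / N).toReal - gReal Xbar f X z|}
  set B : Cand N → Set (Query N → ℝ≥0∞) := fun q => {y | w q <
    |((∑ k : Fin (reps N q.1), y (Sum.inr ⟨q, k⟩)) / (reps N q.1 : ℕ)).toReal -
      gReal Xbar f X (p q)|}
  have hCle : Measure.pi μ C ≤ ENNReal.ofReal (δ / MFCP N) := by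
    refine (pi_abs_mean_sub_gt_le h1 (gReal_mem hf01 hz).1 hN Sum.inl_injective
      (fun k => hmean _) ?_).trans (ENNReal.ofReal_le_ofReal (exp_neg_centerWidth_le hN hδ hδ4))
    unfold etaConc; positivity
  have hBle : ∀ q ∈ S, Measure.pi μ (B q) ≤
      ENNReal.ofReal (δ / MFCP N * (1 / 2 ^ (q.1 : ℕ)) ^ 2) := by
    intro q hq
    have hr : 0 < reps N q.1 := (Finset.mem_filter.1 hq).2
    refine (pi_abs_mean_sub_gt_le h1 (gReal_mem hf01 (hp q)).1 hr
      (e := fun k => Sum.inr ⟨q, k⟩) (fun k k' h => by simpa using h)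
      (fun k => hmean _) (levelWidth_nonneg N δ q.1)).trans
      (ENNReal.ofReal_le_ofReal (exp_neg_levelWidth_le hN hδ hδ4 ?_ hr))
    exact (Finset.mem_Icc.1 q.1.2).1
  have hsub : ∀ᵐ y ∂Measure.pi μ, y ∈ {y | ¬ EstimatesAccurate Xbar f X δ z p y} →
      y ∈ C ∪ ⋃ q ∈ S, B q := by
    filter_upwards [ae_pi_le_one h1] with y hy hbad
    by_contra hno
    simp only [Set.mem_union, Set.mem_iUnion, not_or, not_exists] at hno
    obtain ⟨hnC, hnB⟩ := hno
    have hne : ∀ a, y a ≠ ∞ := fun a => ((hy a).trans_lt ENNReal.one_lt_top).ne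
    refine hbad ⟨⟨?_, ?_⟩, fun q hq => ⟨?_, ?_⟩⟩
    · exact ENNReal.div_ne_top (ENNReal.sum_ne_top.2 fun k _ => hne _)
        (by exact_mod_cast (by omega : N ≠ 0))
    · rw [abs_sub_comm]; exact not_lt.1 hnC
    · exact ENNReal.div_ne_top (ENNReal.sum_ne_top.2 fun k _ => hne _) (by exact_mod_cast hq.ne')
    · rw [abs_sub_comm]; exact not_lt.1 (hnB q (by simpa [S] using hq))
  have hsum : ∑ q ∈ S, (1 / 2 ^ (q.1 : ℕ) : ℝ) ^ 2 ≤ 1 := by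
    calc ∑ q ∈ S, (1 / 2 ^ (q.1 : ℕ) : ℝ) ^ 2
        ≤ ∑ q : Cand N, (1 / 2 ^ (q.1 : ℕ) : ℝ) ^ 2 :=
          Finset.sum_le_sum_of_subset_of_nonneg (Finset.subset_univ _) fun _ _ _ => by positivity
      _ = ∑ i : levels N, (1 / 2 : ℝ) ^ (i : ℕ) := by
          rw [Fintype.sum_sigma]
          refine Finset.sum_congr rfl fun i _ => ?_
          simp only [Finset.sum_const, Finset.card_univ, Fintype.card_fin, nsmul_eq_mul]
          push_cast
          rw [sq, ← mul_assoc, mul_one_div_cancel (by positivity), one_mul, one_div_pow]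
      _ = ∑ i ∈ levels N, (1 / 2 : ℝ) ^ i := Finset.sum_coe_sort (levels N) fun i => (1 / 2 : ℝ) ^ i
      _ ≤ 1 := sum_levels_le N
  have hq0 : 0 ≤ δ / MFCP N := div_nonneg hδ.le (by linarith)
  calc _ ≤ Measure.pi μ (C ∪ ⋃ q ∈ S, B q) := measure_mono_ae hsub
    _ ≤ Measure.pi μ C + ∑ q ∈ S, Measure.pi μ (B q) :=
        (measure_union_le _ _).trans (add_le_add le_rfl (measure_biUnion_finset_le _ _))
    _ ≤ ENNReal.ofReal (δ / MFCP N) +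
        ∑ q ∈ S, ENNReal.ofReal (δ / MFCP N * (1 / 2 ^ (q.1 : ℕ)) ^ 2) :=
        add_le_add hCle (Finset.sum_le_sum hBle)
    _ ≤ ENNReal.ofReal (2 * (δ / MFCP N)) := by
        rw [← ENNReal.ofReal_sum_of_nonneg fun q _ => by positivity,
          ← ENNReal.ofReal_add hq0 (Finset.sum_nonneg fun q _ => by positivity), ← Finset.mul_sum]
        apply ENNReal.ofReal_le_ofReal
        nlinarith

/-! ### The run of the algorithm -/

theorem sum_one_div_sq_le (n : ℕ) :
    ∑ i ∈ Finset.Icc 1 (n + 1), (1 / (i : ℝ) ^ 2) ≤ 2 - 1 / ((n : ℝ) + 1) := by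
  induction n with
  | zero => norm_num
  | succ n ih =>
    rw [Finset.sum_Icc_succ_top (by omega)]
    have h : 1 / ((n : ℝ) + 1 + 1) ^ 2 ≤ 1 / ((n : ℝ) + 1) - 1 / ((n : ℝ) + 1 + 1) := by
      have e : 1 / ((n : ℝ) + 1) - 1 / ((n : ℝ) + 1 + 1) =
          1 / (((n : ℝ) + 1) * ((n : ℝ) + 1 + 1)) := by field_simp; ring
      rw [e, sq]
      gcongr
      linarith
    push_cast
    linarith

/-- Level `i` costs at most `N / i^2`, and `∑ 1 / i^2 ≤ 2`. -/
theorem card_query_le (N : ℕ) : (Fintype.card (Query N) : ℝ) ≤ 3 * N := by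
  have hcard : (Fintype.card (Query N) : ℝ) =
      N + ∑ i ∈ levels N, (2 ^ i * reps N i : ℝ) := by
    rw [← Finset.sum_coe_sort (levels N) fun i => (2 ^ i * reps N i : ℝ)]
    simp [Fintype.card_sum, Fintype.card_sigma, Fintype.sum_sigma]
  have hle : ∀ i ∈ levels N, (2 ^ i * reps N i : ℝ) ≤ N * (1 / (i : ℝ) ^ 2) := by
    intro i hi
    have hi0 : (0 : ℝ) < i := by exact_mod_cast (Finset.mem_Icc.1 hi).1
    have h : (2 ^ i * i ^ 2) * reps N i ≤ N := Nat.mul_div_le N _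
    have h' : (2 ^ i * (i : ℝ) ^ 2) * reps N i ≤ N := by exact_mod_cast h
    rw [mul_one_div, le_div_iff₀ (by positivity)]
    linarith
  have hsum := sum_one_div_sq_le (Nat.log 2 N)
  have h0 : (0 : ℝ) ≤ 1 / ((Nat.log 2 N : ℝ) + 1) := by positivity
  calc (Fintype.card (Query N) : ℝ) ≤ N + ∑ i ∈ levels N, N * (1 / (i : ℝ) ^ 2) := by
        rw [hcard]
        exact add_le_add le_rfl (Finset.sum_le_sum hle)
    _ ≤ N + N * 2 := by
        rw [← Finset.mul_sum]
        gcongr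
        linarith
    _ = 3 * N := by ring

theorem le_card_query (N : ℕ) : N ≤ Fintype.card (Query N) := by
  simp [Fintype.card_sum]

theorem budget_eq (N s : ℕ) : budget N s = (s + 1) * Fintype.card (Query N) := by
  simp [budget]

section run
variable {d N : ℕ} {Ω : Type*} {mΩ : MeasurableSpace Ω} {P : Measure Ω}
  {ℱ : Filtration ℕ mΩ} {Xbar X : Set (E d)} {f : E d → ℝ} {c δ : ℝ} {z₀ : E d}
  {ν : ℕ → Query N → Kernel (E d) ℝ≥0∞}
  {z : ℕ → Ω → E d} {p : ℕ → Ω → Cand N → E d} {obs : ℕ → Ω → Query N → ℝ≥0∞}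

theorem IsFCPRun.measurableSet_reached (hrun : IsFCPRun P ℱ X c δ z₀ ν z p obs) (s : ℕ) :
    MeasurableSet[ℱ (2 * s)] {ω | Reached δ (fun r => obs r ω) s} := by
  have : {ω | Reached δ (fun r => obs r ω) s} =
      ⋂ r : ℕ, ⋂ _ : r < s, ⋃ q, obs r ⁻¹' {y | Eligible δ r y q} := by
    ext ω; simp [Reached]
  rw [this]
  refine MeasurableSet.iInter fun r => MeasurableSet.iInter fun hr => MeasurableSet.iUnion fun q => ?_
  exact ℱ.mono (show 2 * r + 2 ≤ 2 * s by omega) _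
    (hrun.measurable_obs r (measurableSet_eligible r q))

/-- In round `s` a candidate lies outside of its ball, or none improves on the current point although
the latter is neither flat nor nearly optimal. -/
def badCands (N : ℕ) (Xbar : Set (E d)) (f : E d → ℝ) (X : Set (E d)) (xstar : E d) (c δ : ℝ)
    (z₀ : E d) (R : ℝ) (s : ℕ) : Set (E d × (Cand N → E d)) :=
  {a | ∃ q, a.2 q ∉ closedBall a.1 (2 * c)} ∪
    {a | a.1 ∈ closedBall z₀ R ∧ ((17 / 16 : ℝ) ^ s - 1) / N ≤ gReal Xbar f X a.1 - f xstar ∧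
      ¬ FlatOrNearOptimal Xbar f X xstar c N δ a.1 ∧ NoImprovingCand Xbar f X δ s a.1 a.2}

/-- All queries are made in the domain, and some estimate is inaccurate. -/
def badObs (N : ℕ) (Xbar : Set (E d)) (f : E d → ℝ) (X : Set (E d)) (δ : ℝ) (z₀ : E d) (R : ℝ) :
    Set ((E d × (Cand N → E d)) × (Query N → ℝ≥0∞)) :=
  {a | (a.1.1 ∈ closedBall z₀ R ∧ ∀ q, a.1.2 q ∈ closedBall z₀ R) ∧
    ¬ EstimatesAccurate Xbar f X δ a.1.1 a.1.2 a.2}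

variable [IsProbabilityMeasure P] {R : ℝ} {xstar : E d}

/-- Conditioning on the current point `u` reduces this to `pi_noImprovingCand_le`. The margin `2 *
c` in `hR` keeps the ball around `u` inside the domain. -/
theorem IsFCPRun.measure_badCands_le (hrun : IsFCPRun P ℱ X c δ z₀ ν z p obs)
    (hν : ∀ s a, IsObservationKernel Xbar f (ν s a))
    (hf01 : ∀ x ∈ Xbar, f x ∈ Set.Icc (0 : ℝ) 1) (hf : ConvexOn ℝ Xbar f)
    (hc : 0 < c) (hN : 1 ≤ N) (hδ : 0 < δ) (hδ4 : δ < 1 / 4)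
    (hR : ∀ u ∈ closedBall z₀ (R + 2 * c), toX X u ∈ Xbar) (s : ℕ) :
    P ({ω | Reached δ (fun r => obs r ω) s} ∩
      {ω | (z s ω, p s ω) ∈ badCands N Xbar f X xstar c δ z₀ R s}) ≤
      ENNReal.ofReal (δ / MFCP N) := by
  have h2c : 0 < 2 * c := by positivity
  have hκ := hν s (Sum.inl ⟨0, hN⟩)
  have hprob : ∀ u : E d, IsProbabilityMeasure (unif (closedBall u (2 * c))) :=
    fun u => isProbabilityMeasure_unif u h2c
  let K : Kernel (E d) (Cand N → E d) :=
    ⟨fun u => Measure.pi fun _ : Cand N => unif (closedBall u (2 * c)),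
      measurable_measure_pi (κ := fun (_ : Cand N) u => unif (closedBall u (2 * c)))
        fun _ => measurable_unif_closedBall h2c⟩
  have hKapp : ∀ u, K u = Measure.pi fun _ : Cand N => unif (closedBall u (2 * c)) := fun u => rfl
  have hK : IsMarkovKernel K := ⟨fun u => by rw [hKapp]; infer_instance⟩
  have hz : Measurable (z s) := (hrun.measurable_point s).mono (ℱ.le _) le_rfl
  have hp : Measurable (p s) := (hrun.measurable_cand s).mono (ℱ.le _) le_rfl
  refine measure_joint_le hz hp K ?_ ?_ ?_
  · intro D B hD hB
    exact hrun.law_cand s _ B ((hrun.measurableSet_reached s).inter (hrun.measurable_point s hD))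
      (fun ω hω => hω.1) hB
  · refine MeasurableSet.union ?_ ?_
    · have : {a : E d × (Cand N → E d) | ∃ q, a.2 q ∉ closedBall a.1 (2 * c)} =
          ⋃ q, {a | dist (a.2 q) a.1 ≤ 2 * c}ᶜ := by
        ext a; simp
      rw [this]
      refine MeasurableSet.iUnion fun q => (measurableSet_le ?_ measurable_const).compl
      exact ((measurable_pi_apply q).comp measurable_snd).dist measurable_fst
    · refine (measurable_fst measurableSet_closedBall).inter (MeasurableSet.inter ?_
        (MeasurableSet.inter ?_ (measurableSet_noImprovingCand hκ s)))
      · exact measurableSet_le measurable_const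
          (((measurable_gReal hκ).comp measurable_fst).sub_const _)
      · exact measurable_fst (measurableSet_flatOrNearOptimal hκ xstar hc).compl
  · intro u
    rw [hKapp]
    have hnull : Measure.pi (fun _ : Cand N => unif (closedBall u (2 * c)))
        {v | ∃ q, v q ∉ closedBall u (2 * c)} = 0 := by
      have : ∀ᵐ v ∂Measure.pi (fun _ : Cand N => unif (closedBall u (2 * c))),
          ∀ q, v q ∈ closedBall u (2 * c) :=
        Filter.eventually_all.2 fun q => (Measure.quasiMeasurePreserving_eval
          (fun _ : Cand N => unif (closedBall u (2 * c))) q).ae (ae_mem_unif u (2 * c))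
      rw [ae_iff] at this
      simpa using this
    refine (measure_union_le _ _).trans ?_
    change Measure.pi (fun _ : Cand N => unif (closedBall u (2 * c)))
        {v | ∃ q, v q ∉ closedBall u (2 * c)} + _ ≤ _
    rw [hnull, zero_add]
    by_cases hu : u ∈ closedBall z₀ R ∧ ((17 / 16 : ℝ) ^ s - 1) / N ≤ gReal Xbar f X u - f xstar ∧
      ¬ FlatOrNearOptimal Xbar f X xstar c N δ u
    · refine (measure_mono ?_).trans (pi_noImprovingCand_le hκ hf01 hf xstar hc hN hδ hδ4
        (z := u) (s := s) ?_ hu.2.1 hu.2.2)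
      · intro v hv
        exact hv.2.2.2
      · intro w hw
        refine hR w ?_
        rw [mem_closedBall] at hw ⊢
        have := mem_closedBall.1 hu.1
        linarith [dist_triangle w u z₀]
    · refine (measure_mono_null ?_ measure_empty).trans_le zero_le
      intro v hv
      exact hu ⟨hv.1, hv.2.1, hv.2.2.1⟩

theorem IsFCPRun.measure_badObs_le (hrun : IsFCPRun P ℱ X c δ z₀ ν z p obs)
    (hν : ∀ s a, IsObservationKernel Xbar f (ν s a))
    (hf01 : ∀ x ∈ Xbar, f x ∈ Set.Icc (0 : ℝ) 1)
    (hN : 1 ≤ N) (hδ : 0 < δ) (hδ4 : δ < 1 / 4)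
    (hR : ∀ u ∈ closedBall z₀ R, toX X u ∈ Xbar) (s : ℕ) :
    P ({ω | Reached δ (fun r => obs r ω) s} ∩
      {ω | ((z s ω, p s ω), obs s ω) ∈ badObs N Xbar f X δ z₀ R}) ≤
      ENNReal.ofReal (2 * (δ / MFCP N)) := by
  have hmk := fun s a => (hν s a).markov
  have hqm : ∀ a : Query N, Measurable fun h : E d × (Cand N → E d) =>
      toX X (queryPoint h.1 h.2 a) := by
    rintro (k | ⟨q, k⟩)
    · exact continuous_toX.measurable.comp measurable_fst
    · exact continuous_toX.measurable.comp ((measurable_pi_apply q).comp measurable_snd)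
  let K : Kernel (E d × (Cand N → E d)) (Query N → ℝ≥0∞) :=
    ⟨fun h => Measure.pi fun a : Query N => ν s a (toX X (queryPoint h.1 h.2 a)),
      measurable_measure_pi (κ := fun (a : Query N) (h : E d × (Cand N → E d)) =>
        ν s a (toX X (queryPoint h.1 h.2 a))) fun a => (ν s a).measurable.comp (hqm a)⟩
  have hKapp : ∀ h, K h = Measure.pi fun a : Query N => ν s a (toX X (queryPoint h.1 h.2 a)) :=
    fun h => rfl
  have hK : IsMarkovKernel K := ⟨fun h => by rw [hKapp]; infer_instance⟩
  have hzF : Measurable[ℱ (2 * s + 1)] (z s) :=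
    (hrun.measurable_point s).mono (ℱ.mono (Nat.le_succ _)) le_rfl
  have hHF : Measurable[ℱ (2 * s + 1)] fun ω => (z s ω, p s ω) :=
    hzF.prodMk (hrun.measurable_cand s)
  refine measure_joint_le (hHF.mono (ℱ.le _) le_rfl)
    ((hrun.measurable_obs s).mono (ℱ.le _) le_rfl) K ?_ ?_ ?_
  · intro D B hD hB
    exact hrun.law_obs s _ B
      ((ℱ.mono (Nat.le_succ (2 * s)) _ (hrun.measurableSet_reached s)).inter (hHF hD))
      (fun ω hω => hω.1) hB
  · refine MeasurableSet.inter ?_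
      (measurableSet_estimatesAccurate (hν s (Sum.inl ⟨0, hN⟩))).compl
    suffices hs : MeasurableSet {h : E d × (Cand N → E d) | ∀ q, h.2 q ∈ closedBall z₀ R} from
      measurable_fst ((measurable_fst (measurableSet_closedBall (x := z₀) (ε := R))).inter hs)
    have : {h : E d × (Cand N → E d) | ∀ q, h.2 q ∈ closedBall z₀ R} =
        ⋂ q, (fun h => h.2 q) ⁻¹' closedBall z₀ R := by
      ext h; simp
    rw [this]
    exact MeasurableSet.iInter fun q =>
      ((measurable_pi_apply q).comp measurable_snd) measurableSet_closedBall
  · rintro ⟨u, v⟩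
    rw [hKapp]
    by_cases h : u ∈ closedBall z₀ R ∧ ∀ q, v q ∈ closedBall z₀ R
    · refine (measure_mono ?_).trans (pi_not_estimatesAccurate_le (hν s) hf01 hN hδ hδ4
        (hR u h.1) fun q => hR _ (h.2 q))
      intro y hy
      exact hy.2
    · refine (measure_mono_null ?_ measure_empty).trans_le zero_le
      intro y hy
      exact h hy.1

end run

/-! ### Consequences of accurate estimates -/

section deterministic
variable {d N : ℕ} {Xbar X : Set (E d)} {f : E d → ℝ} {δ : ℝ} {z : E d} {p : Cand N → E d}
  {y : Query N → ℝ≥0∞}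

/-- Truncated subtraction does no harm, because a difference cut to `0` cannot reach the positive
threshold. -/
theorem eligible_iff {s : ℕ} {q : Cand N} (hN : 1 ≤ N) (h1 : centerEst y ≠ ∞)
    (h2 : candEst y q ≠ ∞) :
    Eligible δ s y q ↔ 0 < reps N q.1 ∧
      threshold N δ s q.1 ≤ (candEst y q).toReal - (centerEst y).toReal := by
  have ht : 0 < threshold N δ s q.1 := by
    have : (0 : ℝ) < N := by exact_mod_cast hN
    have := levelWidth_nonneg N δ q.1
    rw [threshold_eq]
    positivity
  unfold Eligible
  rw [and_congr_right_iff]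
  intro _
  rcases le_total (centerEst y) (candEst y q) with h | h
  · rw [← ENNReal.toReal_sub_of_le h h2, ENNReal.ofReal_le_iff_le_toReal]
    exact ENNReal.sub_ne_top h2
  · rw [tsub_eq_zero_of_le h]
    have := ENNReal.toReal_mono h1 h
    constructor
    · intro h'
      have := ENNReal.ofReal_eq_zero.1 (le_antisymm h' zero_le)
      linarith
    · intro h'; linarith

/-- The two estimates err by at most two level widths, and the threshold contains four. -/
theorem EstimatesAccurate.improves (h : EstimatesAccurate Xbar f X δ z p y) (hN : 1 ≤ N)
    (hδ : 0 < δ) {s : ℕ} {q : Cand N} (hq : Eligible δ s y q) :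
    gReal Xbar f X z + (17 / 16 : ℝ) ^ s / (16 * N) ≤ gReal Xbar f X (p q) := by
  obtain ⟨⟨h1, h2⟩, h3⟩ := h
  obtain ⟨h4, h5⟩ := h3 q hq.1
  have h6 := ((eligible_iff hN h1 h4).1 hq).2
  rw [threshold_eq] at h6
  have h7 := eta_div_le_levelWidth hN hδ (Finset.mem_Icc.1 q.1.2).1
  have h8 := levelWidth_nonneg N δ q.1
  have h9 := (abs_le.1 h2).2
  have h10 := (abs_le.1 h5).1
  linarith

/-- Four widths from the threshold and two from the errors account for the `6` in `NoImprovingCand`.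
-/
theorem EstimatesAccurate.noImprovingCand (h : EstimatesAccurate Xbar f X δ z p y) (hN : 1 ≤ N)
    (hδ : 0 < δ) {s : ℕ} (hno : ∀ q, ¬ Eligible δ s y q) :
    NoImprovingCand Xbar f X δ s z p := by
  obtain ⟨⟨h1, h2⟩, h3⟩ := h
  intro q hr
  obtain ⟨h4, h5⟩ := h3 q hr
  have h6 := hno q
  rw [eligible_iff hN h1 h4, threshold_eq] at h6
  have h6' := lt_of_not_ge fun h => h6 ⟨hr, h⟩
  have h7 := eta_div_le_levelWidth hN hδ (Finset.mem_Icc.1 q.1.2).1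
  have h9 := (abs_le.1 h2).1
  have h10 := (abs_le.1 h5).2
  linarith

end deterministic

/-! ### Termination and progress when no bad event happens -/

theorem le_MFCP_sub_one {N s : ℕ} (hN : 1 ≤ N) (h : (17 / 16 : ℝ) ^ s ≤ N + 1) :
    (s : ℝ) ≤ MFCP N - 1 := by
  have hN1 : (1 : ℝ) ≤ N := by exact_mod_cast hN
  unfold MFCP
  rw [add_sub_cancel_right, le_div_iff₀ (Real.log_pos (by norm_num)), ← Real.log_pow]
  exact Real.log_le_log (by positivity) (by linarith)

section
variable {d N : ℕ} {Ω : Type*} {mΩ : MeasurableSpace Ω} {P : Measure Ω}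
  {ℱ : Filtration ℕ mΩ} {Xbar X : Set (E d)} {f : E d → ℝ} {c δ : ℝ} {z₀ xstar : E d}
  {ν : ℕ → Query N → Kernel (E d) ℝ≥0∞}
  {z : ℕ → Ω → E d} {p : ℕ → Ω → Cand N → E d} {obs : ℕ → Ω → Query N → ℝ≥0∞}

/-- No bad event happens in round `s`. -/
def GoodRound (Xbar : Set (E d)) (f : E d → ℝ) (X : Set (E d)) (xstar : E d) (c δ : ℝ) (z₀ : E d)
    (z : ℕ → Ω → E d) (p : ℕ → Ω → Cand N → E d) (obs : ℕ → Ω → Query N → ℝ≥0∞) (ω : Ω)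
    (s : ℕ) : Prop :=
  Reached δ (fun r => obs r ω) s →
    (z s ω, p s ω) ∉ badCands N Xbar f X xstar c δ z₀ (2 * (MFCP N - 1) * c) s ∧
    ((z s ω, p s ω), obs s ω) ∉ badObs N Xbar f X δ z₀ (2 * MFCP N * c)

theorem GoodRound.cand_mem {ω : Ω} {s : ℕ} (h : GoodRound Xbar f X xstar c δ z₀ z p obs ω s)
    (hr : Reached δ (fun r => obs r ω) s) (q : Cand N) :
    p s ω q ∈ closedBall (z s ω) (2 * c) := by
  by_contra hq
  exact (h hr).1 (Or.inl ⟨q, hq⟩)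

theorem GoodRound.estimatesAccurate {ω : Ω} {s : ℕ}
    (h : GoodRound Xbar f X xstar c δ z₀ z p obs ω s) (hc : 0 < c)
    (hr : Reached δ (fun r => obs r ω) s) (hz : dist (z s ω) z₀ ≤ 2 * s * c)
    (hs : (s : ℝ) ≤ MFCP N - 1) :
    EstimatesAccurate Xbar f X δ (z s ω) (p s ω) (obs s ω) := by
  have hsc : (s : ℝ) * c ≤ (MFCP N - 1) * c := by gcongr
  by_contra hno
  refine (h hr).2 ⟨⟨?_, fun q => ?_⟩, hno⟩
  · rw [mem_closedBall]; linarith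
  · have := mem_closedBall.1 (h.cand_mem hr q)
    rw [mem_closedBall]
    linarith [dist_triangle (p s ω q) (z s ω) z₀]

/-- The three bounds need each other: the bound on `s` keeps the next point in the domain, where `g
≤ 1`, and then the geometric gain bounds `s + 1`. -/
theorem IsFCPRun.invariant (hrun : IsFCPRun P ℱ X c δ z₀ ν z p obs)
    (hf01 : ∀ x ∈ Xbar, f x ∈ Set.Icc (0 : ℝ) 1) (hc : 0 < c) (hN : 1 ≤ N) (hδ : 0 < δ)
    (hR : ∀ u ∈ closedBall z₀ (2 * MFCP N * c), toX X u ∈ Xbar) {ω : Ω}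
    (hgood : ∀ s : ℕ, (s : ℝ) + 1 ≤ MFCP N → GoodRound Xbar f X xstar c δ z₀ z p obs ω s) (s : ℕ)
    (hr : Reached δ (fun r => obs r ω) s) :
    dist (z s ω) z₀ ≤ 2 * s * c ∧ (s : ℝ) ≤ MFCP N - 1 ∧
      ((17 / 16 : ℝ) ^ s - 1) / N ≤ gReal Xbar f X (z s ω) - gReal Xbar f X z₀ := by
  have hM := twelve_le_MFCP hN
  have hN0 : (0 : ℝ) < N := by exact_mod_cast hN
  induction s with
  | zero =>
    rw [hrun.start]
    refine ⟨by simp, ?_, by simp⟩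
    push_cast
    linarith
  | succ s ih =>
    have hrs : Reached δ (fun r => obs r ω) s := fun r h => hr r (by omega)
    obtain ⟨h1, h2, h3⟩ := ih hrs
    have hg := hgood s (by linarith)
    have hacc := hg.estimatesAccurate hc hrs h1 h2
    obtain ⟨q, hq, hstep⟩ := hrun.step s ω hr
    have himp := hacc.improves hN hδ hq
    have hmem := mem_closedBall.1 (hg.cand_mem hrs q)
    rw [← hstep] at himp hmem
    have hdist : dist (z (s + 1) ω) z₀ ≤ 2 * ((s + 1 : ℕ) : ℝ) * c := by
      push_cast
      linarith [dist_triangle (z (s + 1) ω) (z s ω) z₀]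
    have hin : z (s + 1) ω ∈ closedBall z₀ (2 * MFCP N * c) := by
      rw [mem_closedBall]
      refine hdist.trans ?_
      push_cast
      gcongr
      linarith
    have hz₀ : z₀ ∈ closedBall z₀ (2 * MFCP N * c) := mem_closedBall_self (by positivity)
    have hinc : ((17 / 16 : ℝ) ^ (s + 1) - 1) / N ≤
        gReal Xbar f X (z (s + 1) ω) - gReal Xbar f X z₀ := by
      have e : ((17 / 16 : ℝ) ^ (s + 1) - 1) / N =
          ((17 / 16 : ℝ) ^ s - 1) / N + (17 / 16 : ℝ) ^ s / (16 * N) := by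
        field_simp
        ring
      rw [e]
      linarith
    refine ⟨hdist, le_MFCP_sub_one hN ?_, hinc⟩
    have h4 := (gReal_mem hf01 (hR _ hin)).2
    have h5 := (gReal_mem hf01 (hR _ hz₀)).1
    have h6 : ((17 / 16 : ℝ) ^ (s + 1) - 1) / N ≤ 1 := by linarith
    rw [div_le_one hN0] at h6
    linarith

end

end ZerothOrder

end

/-! ### Union bound over the rounds and conclusion -/

theorem mainTheorem2 {d : ℕ} (hd : 1 ≤ d)
    (Xbar : Set (ZerothOrder.E d)) (hXbar : Convex ℝ Xbar) (hbdd : Bornology.IsBounded Xbar)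
    (f : ZerothOrder.E d → ℝ) (hf : ConvexOn ℝ Xbar f) (hf01 : ∀ x ∈ Xbar, f x ∈ Set.Icc (0 : ℝ) 1)
    (xstar : ZerothOrder.E d) (hxstar : xstar ∈ Xbar) (hmin : IsMinOn f Xbar xstar)
    (X : Set (ZerothOrder.E d)) (hX : Convex ℝ X) (hXsub : X ⊆ Xbar) (hvol : volume X ≠ 0)
    (c : ℝ) (hc : 0 < c) (N : ℕ) (hN : 1 ≤ N) (δ : ℝ) (hδ : 0 < δ)
    (z₀ : ZerothOrder.E d)
    (hball : closedBall z₀ (2 * ZerothOrder.MFCP N * c) ⊆ ZerothOrder.toZ X '' Xbar)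
    {Ω : Type*} {mΩ : MeasurableSpace Ω} (P : Measure Ω) [IsProbabilityMeasure P]
    (ℱ : Filtration ℕ mΩ)
    (ν : ℕ → ZerothOrder.Query N → Kernel (ZerothOrder.E d) ℝ≥0∞)
    (hν : ∀ s a, ZerothOrder.IsObservationKernel Xbar f (ν s a))
    (z : ℕ → Ω → ZerothOrder.E d) (p : ℕ → Ω → ZerothOrder.Cand N → ZerothOrder.E d)
    (obs : ℕ → Ω → ZerothOrder.Query N → ℝ≥0∞)
    (hrun : ZerothOrder.IsFCPRun P ℱ X c δ z₀ ν z p obs) :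
    ENNReal.ofReal (1 - 4 * δ) ≤ P {ω | ∃ τ : ℕ,
      ZerothOrder.ReturnsAt δ (fun r => obs r ω) τ ∧
      -- the returned point is `z τ ω`, the returned estimate is `centerEst (obs τ ω)`
      ((ZerothOrder.smooth Xbar f X (2 * c) (z τ ω) ≠ ∞ ∧
          ZerothOrder.smooth Xbar f X c (z τ ω) ≠ ∞ ∧
          (ZerothOrder.smooth Xbar f X (2 * c) (z τ ω)).toReal
              - (ZerothOrder.smooth Xbar f X c (z τ ω)).toReal
            ≤ (1 / 2 ^ 3) * ((ZerothOrder.smooth Xbar f X c (z τ ω)).toReal - f xstar)) ∨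
        (ZerothOrder.g Xbar f X (z τ ω) ≠ ∞ ∧
          (ZerothOrder.g Xbar f X (z τ ω)).toReal - f xstar
            ≤ 2 ^ 15 * ZerothOrder.etaConc (ZerothOrder.MFCP N / δ)
                * Real.log (2 * ZerothOrder.MFCP N / δ) * (1 / √(N : ℝ)))) ∧
      (ZerothOrder.g Xbar f X (z τ ω) ≠ ∞ ∧ ZerothOrder.centerEst (obs τ ω) ≠ ∞ ∧
        |(ZerothOrder.g Xbar f X (z τ ω)).toReal - (ZerothOrder.centerEst (obs τ ω)).toReal|
          ≤ ZerothOrder.etaConc (ZerothOrder.MFCP N / δ) / √(N : ℝ)) ∧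
      ‖z τ ω - z₀‖ ≤ 2 * ZerothOrder.MFCP N * c ∧
      (N : ℝ) ≤ ZerothOrder.budget N τ ∧
      (ZerothOrder.budget N τ : ℝ) ≤ 4 * ZerothOrder.MFCP N * N} := by
  have hM := ZerothOrder.twelve_le_MFCP hN
  -- For `δ ≥ 1/4` the claimed probability is not positive.
  rcases le_or_gt (1 / 4) δ with hδ4 | hδ4
  · rw [ENNReal.ofReal_of_nonpos (by linarith)]
    exact zero_le
  have hN0 : (0 : ℝ) < N := by exact_mod_cast hN
  have hR : ∀ u ∈ closedBall z₀ (2 * ZerothOrder.MFCP N * c), ZerothOrder.toX X u ∈ Xbar :=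
    fun u hu => ZerothOrder.toX_mem hd (by positivity) hball hu
  have hR' : ∀ u ∈ closedBall z₀ (2 * (ZerothOrder.MFCP N - 1) * c + 2 * c),
      ZerothOrder.toX X u ∈ Xbar := by
    intro u hu
    refine hR u ?_
    rwa [show 2 * ZerothOrder.MFCP N * c = 2 * (ZerothOrder.MFCP N - 1) * c + 2 * c by ring]
  set Bad : ℕ → Set Ω := fun s =>
    {ω | ¬ ZerothOrder.GoodRound Xbar f X xstar c δ z₀ z p obs ω s} with hBad
  have hBadle : ∀ s, P (Bad s) ≤ ENNReal.ofReal (3 * (δ / ZerothOrder.MFCP N)) := by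
    intro s
    have h1 := hrun.measure_badCands_le hν hf01 hf (xstar := xstar) hc hN hδ hδ4 hR' s
    have h2 := hrun.measure_badObs_le hν hf01 hN hδ hδ4 hR s
    have hq : 0 ≤ δ / ZerothOrder.MFCP N := by positivity
    rw [show 3 * (δ / ZerothOrder.MFCP N) =
      δ / ZerothOrder.MFCP N + 2 * (δ / ZerothOrder.MFCP N) by ring,
      ENNReal.ofReal_add hq (by positivity)]
    refine (measure_mono ?_).trans ((measure_union_le _ _).trans (add_le_add h1 h2))
    intro ω hω
    have hω' : ¬ ZerothOrder.GoodRound Xbar f X xstar c δ z₀ z p obs ω s := hω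
    unfold ZerothOrder.GoodRound at hω'
    push Not at hω'
    obtain ⟨hr, hω'⟩ := hω'
    by_cases hcand : (z s ω, p s ω) ∈ ZerothOrder.badCands N Xbar f X xstar c δ z₀
        (2 * (ZerothOrder.MFCP N - 1) * c) s
    · exact Or.inl ⟨hr, hcand⟩
    · exact Or.inr ⟨hr, hω' hcand⟩
  have hBadsum : P (⋃ s ∈ Finset.range ⌊ZerothOrder.MFCP N⌋₊, Bad s) ≤ ENNReal.ofReal (3 * δ) := by
    calc _ ≤ ∑ s ∈ Finset.range ⌊ZerothOrder.MFCP N⌋₊, P (Bad s) := measure_biUnion_finset_le _ _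
      _ ≤ ∑ s ∈ Finset.range ⌊ZerothOrder.MFCP N⌋₊,
          ENNReal.ofReal (3 * (δ / ZerothOrder.MFCP N)) := Finset.sum_le_sum fun s _ => hBadle s
      _ = ENNReal.ofReal (⌊ZerothOrder.MFCP N⌋₊ * (3 * (δ / ZerothOrder.MFCP N))) := by
        rw [Finset.sum_const, Finset.card_range, nsmul_eq_mul,
          ENNReal.ofReal_mul (Nat.cast_nonneg _), ENNReal.ofReal_natCast]
      _ ≤ ENNReal.ofReal (3 * δ) := by
        apply ENNReal.ofReal_le_ofReal
        calc _ ≤ ZerothOrder.MFCP N * (3 * (δ / ZerothOrder.MFCP N)) := by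
              gcongr
              exact Nat.floor_le (by linarith)
          _ = 3 * δ := by field_simp
  refine le_trans (b := P (⋃ s ∈ Finset.range ⌊ZerothOrder.MFCP N⌋₊, Bad s)ᶜ) ?_ (measure_mono ?_)
  · have h1 : 1 ≤ P (⋃ s ∈ Finset.range ⌊ZerothOrder.MFCP N⌋₊, Bad s) +
        P (⋃ s ∈ Finset.range ⌊ZerothOrder.MFCP N⌋₊, Bad s)ᶜ := by
      rw [← measure_univ (μ := P), ← Set.union_compl_self
        (⋃ s ∈ Finset.range ⌊ZerothOrder.MFCP N⌋₊, Bad s)]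
      exact measure_union_le _ _
    rw [show 1 - 4 * δ = 1 - (4 * δ) from rfl, ENNReal.ofReal_sub _ (by positivity),
      ENNReal.ofReal_one, tsub_le_iff_left]
    refine h1.trans (add_le_add_left (hBadsum.trans (ENNReal.ofReal_le_ofReal ?_)) _)
    linarith
  intro ω hω
  have hgood : ∀ s : ℕ, (s : ℝ) + 1 ≤ ZerothOrder.MFCP N →
      ZerothOrder.GoodRound Xbar f X xstar c δ z₀ z p obs ω s := by
    intro s hs
    by_contra hno
    refine hω (Set.mem_biUnion (x := s) ?_ hno)
    have : s + 1 ≤ ⌊ZerothOrder.MFCP N⌋₊ := Nat.le_floor (by exact_mod_cast hs)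
    simpa using this
  have hinv := fun s => hrun.invariant hf01 hc hN hδ hR hgood s
  -- If `FCP` never returned, every round would be reached, against `s ≤ M - 1`.
  have hex : ∃ τ, ZerothOrder.ReturnsAt δ (fun r => obs r ω) τ := by
    by_contra! hno
    have hall : ∀ s, ZerothOrder.Reached δ (fun r => obs r ω) s := by
      intro s
      induction s with
      | zero => intro r hr; omega
      | succ s ih =>
        intro r hr
        rcases Nat.lt_succ_iff_lt_or_eq.1 hr with h | rfl
        · exact ih r h
        · by_contra! hq
          exact hno r ⟨ih, hq⟩
    obtain ⟨s, hs⟩ := exists_nat_gt (ZerothOrder.MFCP N)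
    have := (hinv s (hall s)).2.1
    linarith
  obtain ⟨τ, hτ⟩ := hex
  obtain ⟨h1, h2, h3⟩ := hinv τ hτ.1
  have hg := hgood τ (by linarith)
  have hacc := hg.estimatesAccurate hc hτ.1 h1 h2
  have hni := hacc.noImprovingCand hN hδ hτ.2
  have hτc : (τ : ℝ) * c ≤ (ZerothOrder.MFCP N - 1) * c := by gcongr
  have hdist : dist (z τ ω) z₀ ≤ 2 * ZerothOrder.MFCP N * c := by linarith
  have hz₀ : z₀ ∈ closedBall z₀ (2 * ZerothOrder.MFCP N * c) :=
    mem_closedBall_self (by positivity)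
  have hlow : f xstar ≤ ZerothOrder.gReal Xbar f X z₀ := by
    rw [ZerothOrder.gReal_eq hf01 (hR _ hz₀)]
    exact hmin (hR _ hz₀)
  have hcard := ZerothOrder.card_query_le N
  have hcard' : (N : ℝ) ≤ Fintype.card (ZerothOrder.Query N) := by
    exact_mod_cast ZerothOrder.le_card_query N
  have hτ0 : (0 : ℝ) ≤ τ := Nat.cast_nonneg τ
  refine ⟨τ, hτ, ?_, ⟨ZerothOrder.g_ne_top (hR _ (mem_closedBall.2 hdist)), hacc.1.1, hacc.1.2⟩,
    by rwa [← dist_eq_norm], ?_, ?_⟩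
  · by_contra hflat
    -- A returned point that violates the guarantee is the second alternative in `badCands`. The
    -- gain it requires over `f*` follows from the gain over `g z₀ ≥ f*`.
    refine (hg hτ.1).1 (Or.inr ⟨?_, ?_, hflat, hni⟩)
    · rw [mem_closedBall]; linarith
    · linarith
  · rw [ZerothOrder.budget_eq]
    push_cast
    nlinarith
  · rw [ZerothOrder.budget_eq]
    push_cast
    calc ((τ : ℝ) + 1) * (Fintype.card (ZerothOrder.Query N) : ℝ)
        ≤ ZerothOrder.MFCP N * (3 * N) := by
          gcongr
          linarith
      _ ≤ 4 * ZerothOrder.MFCP N * N := by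
          have : 0 ≤ ZerothOrder.MFCP N * N := by positivity
          linarith
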